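/- Let $n\in\mathbb N$, $\alpha,\beta>0$, $u_0\in L^2(\mathbb R^n)$, and let $u\in C([0,\infty);L^2(\mathbb R^n))$ be the solution (in the sense of tempered distributions) of the free Schrödinger equation $\partial_t u=i\Delta u$, $t>0$, with $u(0)=u_0$. Write $\widehat f(\xi)=(2\pi)^{-n/2}\int_{\mathbb R^n}e^{-ix\cdot\xi}f(x)\,dx$ for the (unitary) Fourier transform on $L^2(\mathbb R^n)$, let $\|\cdot\|_2$ be the $L^2(\mathbb R^n)$ norm, with value $\infty$ for functions not in $L^2$, and put, for $T>0$, $$\theta(t)=\frac{\beta(T-t)}{T(\alpha t+\beta)},\qquad \mu(t)=\frac{\beta}{\alpha t+\beta}.$$ Then for every $\nu\in\mathbb R^n$ the following inequalities hold in $[0,\infty]$, with the conventions $0\cdot\infty=0$ and $\infty^0=0^0=1$ (in particular, each left-hand side is finite whenever the corresponding right-hand side is). (i) For all $T>0$ and $0\le t\le T$, $$\Big\|e^{\frac{|x+2t\nu|^2}{(\alpha t+\beta)^2}}u(t)\Big\|_2\le \Big\|e^{\frac{|x|^2}{\beta^2}}u(0)\Big\|_2^{\theta(t)}\,\Big\|e^{\frac{|x+2T\nu|^2}{(\alpha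 T+\beta)^2}}u(T)\Big\|_2^{1-\theta(t)}.$$ (ii) For all $t\ge 0$, $$\Big\|e^{\frac{|x+2t\nu|^2}{(\alpha t+\beta)^2}}u(t)\Big\|_2\le \Big\|e^{\frac{|x|^2}{\beta^2}}u(0)\Big\|_2^{\mu(t)}\,\Big\|e^{\frac{4|\xi+\nu|^2}{\alpha^2}}\widehat u(0)\Big\|_2^{1-\mu(t)}.$$ -/

import Mathlib

open MeasureTheory Set
open scoped ENNReal SchwartzMap FourierTransform Laplacian

/-- `ℝⁿ` with its Euclidean structure. -/
abbrev Rn (n : ℕ) : Type := EuclideanSpace ℝ (Fin n)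

/-- Complex-valued `L²(ℝⁿ)`. -/
abbrev L2Rn (n : ℕ) : Type := Lp (α := Rn n) ℂ 2

/-- `u ∈ C([0,∞); L²(ℝⁿ))` is the solution of the free Schrödinger initial value problem
`∂ₜu = iΔu` for `t > 0`, `u(0) = u₀`. The equation is understood in the sense of tempered
distributions: for every Schwartz function `φ` and every `t > 0`,
`d/dt ∫ φ(x) u(x,t) dx = ∫ (Δφ)(x) (i u(x,t)) dx`. -/
structure IsFreeSchrodingerSolution {n : ℕ} (u₀ : L2Rn n) (u : ℝ → L2Rn n) : Prop where
  continuousOn : ContinuousOn u (Ici 0)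
  initial : u 0 = u₀
  equation : ∀ φ : 𝓢(Rn n, ℂ), ∀ t : ℝ, 0 < t →
    HasDerivAt (fun s : ℝ => ∫ x, φ x * u s x)
      (∫ x, (Δ φ) x * (Complex.I * u t x)) t

/-- The unitary Fourier transform on `L²(ℝⁿ)` normalized by
`f̂(ξ) = (2π)^(-n/2) ∫ e^(-i x·ξ) f(x) dx`, obtained by rescaling Mathlib's `L²` Fourier transform
`𝓕`, which is normalized by `𝓕 f (ξ) = ∫ e^(-2πi x·ξ) f(x) dx`. (The dilation preserves null
sets, so this is well defined almost everywhere.) -/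
noncomputable def fourierHat {n : ℕ} (f : L2Rn n) : Rn n → ℂ := fun ξ =>
  (((2 * Real.pi) ^ (-(n : ℝ) / 2) : ℝ) : ℂ) * (𝓕 f : L2Rn n) ((2 * Real.pi)⁻¹ • ξ)

/-- The weighted norm `‖e^w f‖₂`, with value `∞` when `e^w f ∉ L²(ℝⁿ)`. -/
noncomputable def expWeightNorm {n : ℕ} (w : Rn n → ℝ) (f : Rn n → ℂ) : ℝ≥0∞ :=
  eLpNorm (fun x => (Real.exp (w x) : ℂ) * f x) 2 volume

/-!
For integrable `u₀` and `t > 0`, the solution `u t` is, up to factors of constant modulus, a dilate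
of the Fourier transform of the chirped datum `e^{i|x|²/4t} u₀`. Taking `f = e^{i|x|²/4T} u₀` for
the first inequality and `f = u₀` for the second, both say that the norm of
`e^{|ξ+c|²/r²} 𝓕(e^{is|x|²} f)` is at most a geometric mean of Gaussian-weighted norms of `f` and
`𝓕 f`.

A squared Gaussian weight is an average of squared exponentials `e^{⟪v, x⟫}` over Gaussian `v`, so
by Hölder's inequality it suffices to treat the weights `e^{⟪v, x⟫}`. For those, pair with a test
function `g`: the integral `∫ e^{p⟪v, x⟫} e^{is|x|²} f(x) 𝓕(e^{q⟪v, ·⟫} g)(x) dx` is entire in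
`(p, q)`, and the three lines theorem is applied along a complex line in `(p, q)`. On one edge of
the strip `q` is imaginary and the integral is controlled by `f`; on the other, completing the
square moves the chirp from `f` to `g`, and the integral is controlled by `𝓕 f`.
-/

section FourierL2

variable {V : Type*} [NormedAddCommGroup V] [InnerProductSpace ℝ V] [FiniteDimensional ℝ V]
  [MeasurableSpace V] [BorelSpace V]

theorem integral_mul_fourier_of_integrable {f g : V → ℂ} (hf : Integrable f) (hg : Integrable g) :
    ∫ x, f x * 𝓕 g x = ∫ x, 𝓕 f x * g x := by
  simpa using! (VectorFourier.integral_fourierIntegral_smul_eq_flip (L := innerₗ V)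
    Real.continuous_fourierChar continuous_inner hf hg).symm

theorem continuous_fourier_of_integrable {f : V → ℂ} (hf : Integrable f) : Continuous (𝓕 f) :=
  VectorFourier.fourierIntegral_continuous Real.continuous_fourierChar
    (L := innerₗ V) continuous_inner hf

theorem fourier_comp_add_right (f : V → ℂ) (w ξ : V) :
    𝓕 (fun x => f (x + w)) ξ =
      Complex.exp ((2 * Real.pi * inner ℝ w ξ : ℝ) * Complex.I) * 𝓕 f ξ := by
  have h := congrFun
    (VectorFourier.fourierIntegral_comp_add_right Real.fourierChar volume (innerₗ V) f w) ξ
  simpa [Circle.smul_def, Real.fourierChar_apply] using! h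

theorem integral_mul_fourier_schwartz (φ : 𝓢(V, ℂ)) (f : Lp (α := V) ℂ 2) :
    ∫ x, φ x * (𝓕 f : Lp (α := V) ℂ 2) x = ∫ x, (𝓕 φ) x * f x := by
  simpa using (congrArg (fun T => T φ) (Lp.fourier_toTemperedDistribution_eq f)).symm

theorem ae_eq_of_integral_schwartz_mul_eq {f g : V → ℂ} (hf : LocallyIntegrable f)
    (hg : LocallyIntegrable g)
    (h : ∀ φ : 𝓢(V, ℂ), HasCompactSupport φ → ∫ x, φ x * f x = ∫ x, φ x * g x) :
    f =ᵐ[volume] g := by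
  refine ae_eq_of_integral_contDiff_smul_eq hf hg fun χ hχ hχc => ?_
  have hsupp : HasCompactSupport (Complex.ofRealCLM ∘ χ) := hχc.comp_left rfl
  have hsmooth : ContDiff ℝ (⊤ : ℕ∞) (Complex.ofRealCLM ∘ χ) := by fun_prop
  simpa using h (hsupp.toSchwartzMap hsmooth) hsupp

theorem coeFn_fourier_toLp {f : V → ℂ} (hf : Integrable f) (hf₂ : MemLp f 2) :
    (𝓕 (hf₂.toLp f) : Lp (α := V) ℂ 2) =ᵐ[volume] 𝓕 f := by
  refine ae_eq_of_integral_schwartz_mul_eq ((Lp.memLp _).locallyIntegrable one_le_two)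
    (continuous_fourier_of_integrable hf).locallyIntegrable fun φ _ => ?_
  rw [integral_mul_fourier_schwartz, integral_mul_fourier_of_integrable φ.integrable hf,
    SchwartzMap.fourier_coe]
  exact integral_congr_ae (hf₂.coeFn_toLp.mono fun x hx => by simp only [hx])

theorem eLpNorm_fourier_L2 (f : Lp (α := V) ℂ 2) :
    eLpNorm (𝓕 f : Lp (α := V) ℂ 2) 2 = eLpNorm f 2 := by
  rw [← Lp.enorm_def, ← Lp.enorm_def, ← ofReal_norm, ← ofReal_norm, Lp.norm_fourier_eq]

theorem memLp_fourier {f : V → ℂ} (hf : Integrable f) (hf₂ : MemLp f 2) : MemLp (𝓕 f) 2 :=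
  (memLp_congr_ae (coeFn_fourier_toLp hf hf₂)).1 (Lp.memLp _)

theorem eLpNorm_fourier {f : V → ℂ} (hf : Integrable f) (hf₂ : MemLp f 2) :
    eLpNorm (𝓕 f) 2 = eLpNorm f 2 := by
  rw [← eLpNorm_congr_ae (coeFn_fourier_toLp hf hf₂), eLpNorm_fourier_L2,
    eLpNorm_congr_ae hf₂.coeFn_toLp]

/-- The bilinear (not sesquilinear) pairing `∫ f g` on `L²`. -/
noncomputable def pairingL2 : Lp (α := V) ℂ 2 →L[ℝ] Lp (α := V) ℂ 2 →L[ℝ] ℂ :=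
  (ContinuousLinearMap.mul ℝ ℂ).lpPairing volume 2 2

theorem pairingL2_apply (f g : Lp (α := V) ℂ 2) : pairingL2 f g = ∫ x, f x * g x := by
  rw [pairingL2, ContinuousLinearMap.lpPairing_eq_integral]
  rfl

theorem pairingL2_schwartz (φ : 𝓢(V, ℂ)) (f : Lp (α := V) ℂ 2) :
    pairingL2 (φ.toLp 2) f = ∫ x, φ x * f x := by
  rw [pairingL2_apply]
  exact integral_congr_ae ((φ.coeFn_toLp 2 volume).mono fun x hx => by simp only [hx])

theorem pairingL2_fourier (f g : Lp (α := V) ℂ 2) : pairingL2 f (𝓕 g) = pairingL2 (𝓕 f) g := by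
  have : Continuous fun f : Lp (α := V) ℂ 2 => (𝓕 f : Lp (α := V) ℂ 2) :=
    (Lp.fourierTransformₗᵢ V ℂ).continuous
  have hdense : DenseRange (SchwartzMap.toLpCLM ℝ ℂ 2 (volume : Measure V)) :=
    SchwartzMap.denseRange_toLpCLM ENNReal.ofNat_ne_top
  refine hdense.induction_on f (isClosed_eq (by fun_prop) (by fun_prop)) fun φ => ?_
  simp only [SchwartzMap.toLpCLM_apply, SchwartzMap.toLp_fourier_eq, pairingL2_schwartz,
    integral_mul_fourier_schwartz]

theorem integral_mul_fourier_L2 {f : V → ℂ} (hf : Integrable f) (hf₂ : MemLp f 2)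
    (g : Lp (α := V) ℂ 2) : ∫ x, f x * (𝓕 g : Lp (α := V) ℂ 2) x = ∫ x, 𝓕 f x * g x := by
  have h := pairingL2_fourier (hf₂.toLp f) g
  rw [pairingL2_apply, pairingL2_apply] at h
  convert h using 1
  · exact integral_congr_ae (hf₂.coeFn_toLp.mono fun x hx => by simp only [hx])
  · exact integral_congr_ae ((coeFn_fourier_toLp hf hf₂).mono fun x hx => by simp only [hx])

end FourierL2

section SchrodingerPhase

variable {V : Type*} [NormedAddCommGroup V]

/-- The inverse `e^{i(2π)²s|ξ|²}` of the free Schrödinger propagator at time `s` on the Fourier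
side, for Mathlib's normalization of the Fourier transform. -/
noncomputable def schrodingerPhase (s : ℝ) (ξ : V) : ℂ :=
  Complex.exp (((2 * Real.pi) ^ 2 * ‖ξ‖ ^ 2 * s : ℝ) * Complex.I)

theorem norm_schrodingerPhase (s : ℝ) (ξ : V) : ‖schrodingerPhase s ξ‖ = 1 :=
  Complex.norm_exp_ofReal_mul_I _

theorem norm_schrodingerPhase_add_sub_sub_le {s h M : ℝ} (hM : 0 < M) (hh : |h| ≤ M⁻¹) {ξ : V}
    (hξ : (2 * Real.pi) ^ 2 * ‖ξ‖ ^ 2 ≤ M) :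
    ‖schrodingerPhase (s + h) ξ - schrodingerPhase s ξ
      - h * (Complex.I * (((2 * Real.pi) ^ 2 * ‖ξ‖ ^ 2 : ℝ) * schrodingerPhase s ξ))‖
      ≤ M ^ 2 * h ^ 2 := by
  set p : ℝ := (2 * Real.pi) ^ 2 * ‖ξ‖ ^ 2 with hp
  have hnorm : ‖((p * h : ℝ) : ℂ) * Complex.I‖ = p * |h| := by
    rw [norm_mul, Complex.norm_I, mul_one, Complex.norm_real, Real.norm_eq_abs, abs_mul,
      abs_of_nonneg (by positivity : 0 ≤ p)]
  have hsmall : ‖((p * h : ℝ) : ℂ) * Complex.I‖ ≤ 1 := by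
    rw [hnorm, ← mul_inv_cancel₀ hM.ne']
    gcongr
  have hfactor : schrodingerPhase (s + h) ξ - schrodingerPhase s ξ
      - h * (Complex.I * (p * schrodingerPhase s ξ))
      = schrodingerPhase s ξ * (Complex.exp (((p * h : ℝ) : ℂ) * Complex.I) - 1
        - ((p * h : ℝ) : ℂ) * Complex.I) := by
    rw [schrodingerPhase, schrodingerPhase, ← hp, mul_add, Complex.ofReal_add, add_mul,
      Complex.exp_add]
    push_cast
    ring
  rw [hfactor, norm_mul, norm_schrodingerPhase, one_mul]
  refine (Complex.norm_exp_sub_one_sub_id_le hsmall).trans ?_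
  rw [hnorm, mul_pow, sq_abs]
  gcongr

variable [InnerProductSpace ℝ V]

theorem contDiff_schrodingerPhase (s : ℝ) :
    ContDiff ℝ (⊤ : ℕ∞) (schrodingerPhase s : V → ℂ) := by
  have h : ContDiff ℝ (⊤ : ℕ∞) (fun ξ : V => (2 * Real.pi) ^ 2 * ‖ξ‖ ^ 2 * s) :=
    (contDiff_const.mul (contDiff_norm_sq ℝ)).mul contDiff_const
  exact ((Complex.ofRealCLM.contDiff.comp h).mul contDiff_const).cexp

/-- The Schwartz function `ξ ↦ e^{i(2π)²s|ξ|²} φ(ξ)`, for a test function `φ`. -/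
noncomputable def phaseTest (φ : 𝓢(V, ℂ)) (hφ : HasCompactSupport φ) (s : ℝ) : 𝓢(V, ℂ) :=
  (hφ.mul_right (f' := schrodingerPhase s)).toSchwartzMap
    ((φ.smooth _).mul (contDiff_schrodingerPhase s))

theorem phaseTest_apply (φ : 𝓢(V, ℂ)) (hφ : HasCompactSupport φ) (s : ℝ) (ξ : V) :
    phaseTest φ hφ s ξ = φ ξ * schrodingerPhase s ξ := rfl

/-- The Schwartz function `ξ ↦ i(2π)²|ξ|² φ(ξ)`, the image of `φ` under the Fourier symbol of
`-iΔ`. -/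
noncomputable def symbolTest (φ : 𝓢(V, ℂ)) : 𝓢(V, ℂ) :=
  (Complex.I * (2 * Real.pi) ^ 2) • SchwartzMap.smulLeftCLM ℂ (fun ξ : V => ((‖ξ‖ ^ 2 : ℝ) : ℂ)) φ

theorem symbolTest_apply (φ : 𝓢(V, ℂ)) (ξ : V) :
    symbolTest φ ξ = Complex.I * (((2 * Real.pi) ^ 2 * ‖ξ‖ ^ 2 : ℝ) * φ ξ) := by
  have h : (fun ξ : V => ((‖ξ‖ ^ 2 : ℝ) : ℂ)).HasTemperateGrowth := by fun_prop
  simp only [symbolTest, smul_apply, SchwartzMap.smulLeftCLM_apply_apply h, smul_eq_mul]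
  push_cast
  ring

variable [FiniteDimensional ℝ V] [MeasurableSpace V] [BorelSpace V]

theorem norm_sub_sub_smul_le_of_ae {a b c d : Lp (α := V) ℂ 2 volume} {h C : ℝ}
    (H : ∀ᵐ ξ ∂(volume : Measure V), ‖a ξ - b ξ - h * c ξ‖ ≤ C * ‖d ξ‖) :
    ‖a - b - h • c‖ ≤ C * ‖d‖ := by
  refine Lp.norm_le_mul_norm_of_ae_le_mul ?_
  filter_upwards [H, Lp.coeFn_sub (a - b) (h • c), Lp.coeFn_sub a b, Lp.coeFn_smul h c]
    with ξ hξ hsub hsub' hsmul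
  rwa [hsub, Pi.sub_apply, hsub', Pi.sub_apply, hsmul, Pi.smul_apply, Complex.real_smul]

theorem norm_toLp_phaseTest_add_sub_sub_le (φ : 𝓢(V, ℂ)) (hφ : HasCompactSupport φ) {s h R : ℝ}
    (hR : ∀ ξ ∈ tsupport φ, ‖ξ‖ ≤ R) (hh : |h| ≤ ((2 * Real.pi) ^ 2 * R ^ 2 + 1)⁻¹) :
    ‖(phaseTest φ hφ (s + h)).toLp 2 volume - (phaseTest φ hφ s).toLp 2 volume
        - h • (symbolTest (phaseTest φ hφ s)).toLp 2 volume‖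
      ≤ (((2 * Real.pi) ^ 2 * R ^ 2 + 1) ^ 2 * h ^ 2) * ‖φ.toLp 2 volume‖ := by
  refine norm_sub_sub_smul_le_of_ae ?_
  filter_upwards [(phaseTest φ hφ (s + h)).coeFn_toLp 2 volume,
    (phaseTest φ hφ s).coeFn_toLp 2 volume, (symbolTest (phaseTest φ hφ s)).coeFn_toLp 2 volume,
    φ.coeFn_toLp 2 volume] with ξ hadd hs hsymb hφξ
  rw [hadd, hs, hsymb, hφξ, symbolTest_apply, phaseTest_apply, phaseTest_apply]
  by_cases hξ : φ ξ = 0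
  · simp [hξ]
  have hfactor : φ ξ * schrodingerPhase (s + h) ξ - φ ξ * schrodingerPhase s ξ - h *
      (Complex.I * (((2 * Real.pi) ^ 2 * ‖ξ‖ ^ 2 : ℝ) * (φ ξ * schrodingerPhase s ξ)))
      = φ ξ * (schrodingerPhase (s + h) ξ - schrodingerPhase s ξ
        - h * (Complex.I * (((2 * Real.pi) ^ 2 * ‖ξ‖ ^ 2 : ℝ) * schrodingerPhase s ξ))) := by
    ring
  rw [hfactor, norm_mul, mul_comm]
  gcongr
  refine norm_schrodingerPhase_add_sub_sub_le (by positivity) hh ?_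
  have hξR := hR ξ (subset_tsupport _ hξ)
  calc (2 * Real.pi) ^ 2 * ‖ξ‖ ^ 2 ≤ (2 * Real.pi) ^ 2 * R ^ 2 := by gcongr
    _ ≤ (2 * Real.pi) ^ 2 * R ^ 2 + 1 := by linarith

theorem hasDerivAt_toLp_phaseTest (φ : 𝓢(V, ℂ)) (hφ : HasCompactSupport φ) (s : ℝ) :
    HasDerivAt (fun r => (phaseTest φ hφ r).toLp 2 (volume : Measure V))
      ((symbolTest (phaseTest φ hφ s)).toLp 2) s := by
  obtain ⟨R, hR⟩ := hφ.isBounded.exists_norm_le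
  set M : ℝ := (2 * Real.pi) ^ 2 * R ^ 2 + 1
  rw [hasDerivAt_iff_isLittleO_nhds_zero]
  refine Asymptotics.IsBigO.trans_isLittleO (g := fun h : ℝ => h ^ 2) ?_
    (by simpa using Asymptotics.isLittleO_pow_id (𝕜 := ℝ) one_lt_two)
  refine Asymptotics.IsBigO.of_bound (M ^ 2 * ‖φ.toLp 2 (volume : Measure V)‖) ?_
  filter_upwards [Metric.ball_mem_nhds (0 : ℝ) (ε := M⁻¹) (by positivity)] with h hh
  rw [Real.norm_of_nonneg (sq_nonneg h), mul_right_comm]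
  exact norm_toLp_phaseTest_add_sub_sub_le φ hφ hR (by simpa using (mem_ball_zero_iff.1 hh).le)

theorem locallyIntegrable_schrodingerPhase_mul (s : ℝ) (f : Lp (α := V) ℂ 2) :
    LocallyIntegrable (fun ξ => schrodingerPhase s ξ * f ξ) := by
  refine MemLp.locallyIntegrable (p := 2) ((Lp.memLp f).of_le
    ((contDiff_schrodingerPhase s).continuous.aestronglyMeasurable.mul
      (Lp.aestronglyMeasurable f)) (ae_of_all _ fun ξ => ?_)) one_le_two
  rw [norm_mul, norm_schrodingerPhase, one_mul]

theorem integral_laplacian_fourier_mul (ψ : 𝓢(V, ℂ)) (f : Lp (α := V) ℂ 2) :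
    ∫ x, (Δ (𝓕 ψ)) x * (Complex.I * f x) =
      -∫ ξ : V, symbolTest ψ ξ * (𝓕 f : Lp (α := V) ℂ 2) ξ := by
  have h := congrArg (fun T => T (𝓕 ψ)) (TemperedDistribution.laplacian_eq_fourierMultiplierCLM
    (Lp.toTemperedDistribution f))
  simp only [TemperedDistribution.laplacian_apply_apply, Lp.toTemperedDistribution_apply,
    smul_eq_mul, neg_smul, neg_apply, smul_apply,
    TemperedDistribution.fourierMultiplierCLM_apply_apply, FourierPair.fourierInv_fourier_eq,
    Complex.real_smul] at h
  calc ∫ x, (Δ (𝓕 ψ)) x * (Complex.I * f x)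
      = Complex.I * ∫ x, (Δ (𝓕 ψ)) x * f x := by
        rw [← integral_const_mul]
        exact integral_congr_ae (ae_of_all _ fun x => by ring)
    _ = -∫ ξ : V, symbolTest ψ ξ * (𝓕 f : Lp (α := V) ℂ 2 volume) ξ := by
        rw [h, ← integral_mul_fourier_schwartz, mul_neg, ← mul_assoc, ← integral_const_mul]
        simp only [symbolTest, smul_apply, smul_eq_mul, Complex.ofReal_pow, Complex.ofReal_mul,
          Complex.ofReal_ofNat, mul_assoc]

end SchrodingerPhase

open Filter Topology in
theorem hasDerivAt_clm_apply_of_weak {E F G : Type*} [NormedAddCommGroup E] [NormedSpace ℝ E]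
    [NormedAddCommGroup F] [NormedSpace ℝ F] [NormedAddCommGroup G] [NormedSpace ℝ G]
    (B : E →L[ℝ] F →L[ℝ] G) {A : ℝ → E} {A' : E} {U : ℝ → F} {c : G} {s : ℝ}
    (hA : HasDerivAt A A' s) (hU : ContinuousAt U s)
    (hw : HasDerivAt (fun r => B (A s) (U r)) c s) :
    HasDerivAt (fun r => B (A r) (U r)) (B A' (U s) + c) s := by
  rw [hasDerivAt_iff_tendsto_slope] at hA hw ⊢
  have hslope : Tendsto (fun r => B (slope A s r) (U r)) (𝓝[≠] s) (𝓝 (B A' (U s))) :=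
    (isBoundedBilinearMap_apply.continuous.tendsto (B A', U s)).comp
      (((B.continuous.tendsto A').comp hA).prodMk_nhds
        (hU.tendsto.mono_left nhdsWithin_le_nhds))
  refine (hslope.add hw).congr fun r => ?_
  simp only [slope_def_module, map_smul, map_sub, smul_apply, sub_apply, smul_sub]
  abel

namespace IsFreeSchrodingerSolution

variable {n : ℕ} {u₀ : L2Rn n} {u : ℝ → L2Rn n}

theorem continuousOn_fourier (hu : IsFreeSchrodingerSolution u₀ u) :
    ContinuousOn (fun s => (𝓕 (u s) : L2Rn n)) (Ici 0) :=
  (Lp.fourierTransformₗᵢ (Rn n) ℂ).continuous.comp_continuousOn hu.continuousOn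

theorem hasDerivAt_pairingL2_fourier (hu : IsFreeSchrodingerSolution u₀ u) (ψ : 𝓢(Rn n, ℂ))
    {s : ℝ} (hs : 0 < s) :
    HasDerivAt (fun r => pairingL2 (ψ.toLp 2) (𝓕 (u r)))
      (-pairingL2 ((symbolTest ψ).toLp 2) (𝓕 (u s))) s := by
  have h := hu.equation (𝓕 ψ) s hs
  rw [integral_laplacian_fourier_mul] at h
  simpa only [pairingL2_schwartz, integral_mul_fourier_schwartz] using h

theorem hasDerivAt_pairingL2_phaseTest (hu : IsFreeSchrodingerSolution u₀ u) (φ : 𝓢(Rn n, ℂ))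
    (hφ : HasCompactSupport φ) {s : ℝ} (hs : 0 < s) :
    HasDerivAt (fun r => pairingL2 ((phaseTest φ hφ r).toLp 2 volume) (𝓕 (u r))) 0 s := by
  have h := hasDerivAt_clm_apply_of_weak pairingL2 (hasDerivAt_toLp_phaseTest φ hφ s)
    (hu.continuousOn_fourier.continuousAt (Ici_mem_nhds hs))
    (hu.hasDerivAt_pairingL2_fourier (phaseTest φ hφ s) hs)
  rwa [add_neg_cancel] at h

open Filter Topology in
theorem pairingL2_phaseTest_eq (hu : IsFreeSchrodingerSolution u₀ u) (φ : 𝓢(Rn n, ℂ))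
    (hφ : HasCompactSupport φ) {t : ℝ} (ht : 0 ≤ t) :
    pairingL2 ((phaseTest φ hφ t).toLp 2) (𝓕 (u t)) =
      pairingL2 ((phaseTest φ hφ 0).toLp 2) (𝓕 (u 0)) := by
  set D : ℝ → ℂ := fun s => pairingL2 ((phaseTest φ hφ s).toLp 2) (𝓕 (u s))
  have hphase : Continuous (fun r => (phaseTest φ hφ r).toLp 2 (volume : Measure (Rn n))) :=
    continuous_iff_continuousAt.2 fun s => (hasDerivAt_toLp_phaseTest φ hφ s).continuousAt
  have hcont : ContinuousOn D (Ici 0) :=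
    (pairingL2.continuous.comp hphase).continuousOn.clm_apply hu.continuousOn_fourier
  have hderiv : ∀ s ∈ Ioi (0 : ℝ), HasDerivAt D 0 s := fun s hs =>
    hu.hasDerivAt_pairingL2_phaseTest φ hφ hs
  obtain ⟨c, hc⟩ := isOpen_Ioi.exists_is_const_of_deriv_eq_zero isPreconnected_Ioi
    (fun s hs => (hderiv s hs).differentiableAt.differentiableWithinAt)
    (fun s hs => (hderiv s hs).deriv)
  have hconst : EqOn D (fun _ => c) (Ici 0) :=
    EqOn.of_subset_closure hc hcont continuousOn_const Ioi_subset_Ici_self (closure_Ioi 0).ge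
  exact (hconst ht).trans (hconst self_mem_Ici).symm

theorem schrodingerPhase_mul_fourier_ae_eq (hu : IsFreeSchrodingerSolution u₀ u) {t : ℝ}
    (ht : 0 ≤ t) :
    ∀ᵐ ξ, schrodingerPhase t ξ * (𝓕 (u t) : L2Rn n) ξ = (𝓕 (u 0) : L2Rn n) ξ := by
  refine ae_eq_of_integral_schwartz_mul_eq (locallyIntegrable_schrodingerPhase_mul t _)
    ((Lp.memLp _).locallyIntegrable one_le_two) fun φ hφ => ?_
  have h := hu.pairingL2_phaseTest_eq φ hφ ht
  simp only [pairingL2_schwartz, phaseTest_apply] at h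
  simpa [schrodingerPhase, mul_assoc] using h

end IsFreeSchrodingerSolution

section Chirp

variable {V : Type*} [NormedAddCommGroup V]

/-- The multiplication `f ↦ e^{is|x|²} f` by a quadratic phase. -/
noncomputable def chirp (s : ℝ) (f : V → ℂ) (x : V) : ℂ :=
  Complex.exp ((s * ‖x‖ ^ 2 : ℝ) * Complex.I) * f x

theorem norm_chirp (s : ℝ) (f : V → ℂ) (x : V) : ‖chirp s f x‖ = ‖f x‖ := by
  rw [chirp, norm_mul, Complex.norm_exp_ofReal_mul_I, one_mul]

theorem chirp_chirp (s r : ℝ) (f : V → ℂ) : chirp s (chirp r f) = chirp (s + r) f := by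
  funext x
  rw [chirp, chirp, chirp, ← mul_assoc, ← Complex.exp_add, add_mul, Complex.ofReal_add, add_mul]

theorem aestronglyMeasurable_chirp [MeasurableSpace V] [BorelSpace V] [SecondCountableTopology V]
    {μ : Measure V} (s : ℝ) {f : V → ℂ}
    (hf : AEStronglyMeasurable f μ) : AEStronglyMeasurable (chirp s f) μ :=
  (Continuous.aestronglyMeasurable (by fun_prop)).mul hf

theorem integrable_chirp [MeasurableSpace V] [BorelSpace V] [SecondCountableTopology V]
    {μ : Measure V} (s : ℝ) {f : V → ℂ} (hf : Integrable f μ) : Integrable (chirp s f) μ :=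
  hf.congr' (aestronglyMeasurable_chirp s hf.1) (ae_of_all _ fun x => (norm_chirp s f x).symm)

end Chirp

section FresnelKernel

/-- The constant `(4πit)^{-n/2}` of the Schrödinger kernel in dimension `n`. -/
noncomputable def fresnelConst (n : ℕ) (t : ℝ) : ℂ :=
  (Real.pi / ((2 * Real.pi) ^ 2 * t * Complex.I)) ^ (n / 2 : ℂ)

theorem norm_fresnelConst (n : ℕ) {t : ℝ} (ht : 0 < t) :
    ‖fresnelConst n t‖ = (4 * Real.pi * t)⁻¹ ^ ((n : ℝ) / 2) := by
  have hn : (n / 2 : ℂ) = ((n / 2 : ℝ) : ℂ) := by push_cast; rfl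
  have hnorm : ‖(Real.pi / ((2 * Real.pi) ^ 2 * t * Complex.I) : ℂ)‖ = (4 * Real.pi * t)⁻¹ := by
    simp only [norm_div, norm_mul, norm_pow, Complex.norm_real, Complex.norm_I, mul_one,
      Complex.norm_ofNat, Real.norm_eq_abs, abs_of_pos Real.pi_pos, abs_of_pos ht]
    field_simp
    norm_num
  rw [fresnelConst, hn, Complex.norm_cpow_real, hnorm]

open Filter Topology

variable {V : Type*} [NormedAddCommGroup V] [InnerProductSpace ℝ V] [FiniteDimensional ℝ V]
  [MeasurableSpace V] [BorelSpace V]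

theorem integral_gaussian_mul_fourier {f : V → ℂ} (hf : Integrable f) {b : ℂ} (hb : 0 < b.re)
    (y : V) :
    ∫ ξ, Complex.exp (-b * ‖ξ‖ ^ 2 + 2 * Real.pi * Complex.I * inner ℝ y ξ) * 𝓕 f ξ =
      (Real.pi / b) ^ (Module.finrank ℝ V / 2 : ℂ) *
        ∫ x, Complex.exp (-Real.pi ^ 2 * ‖y - x‖ ^ 2 / b) * f x := by
  rw [integral_mul_fourier_of_integrable
    (GaussianFourier.integrable_cexp_neg_mul_sq_norm_add hb (2 * Real.pi * Complex.I) y) hf,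
    ← integral_const_mul]
  exact integral_congr_ae (ae_of_all _ fun x => by
    beta_reduce
    rw [fourier_gaussian_innerProductSpace' hb y x, mul_assoc])

theorem continuousWithinAt_integral_cexp_mul {g : V → ℂ} (hg : Integrable g) {b₀ : ℂ} {S : Set ℂ}
    {e : ℂ → V → ℂ} (he : ∀ b ∈ S, Continuous (e b)) (hre : ∀ b ∈ S, ∀ x, (e b x).re ≤ 0)
    (hb₀ : ∀ x, ContinuousWithinAt (fun b => e b x) S b₀) :
    ContinuousWithinAt (fun b => ∫ x, Complex.exp (e b x) * g x) S b₀ := by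
  refine continuousWithinAt_of_dominated (bound := fun x => ‖g x‖)
    (eventually_mem_nhdsWithin.mono fun b hb =>
      (he b hb).cexp.aestronglyMeasurable.mul hg.1)
    (eventually_mem_nhdsWithin.mono fun b hb => ae_of_all _ fun x => ?_) hg.norm
    (ae_of_all _ fun x => (hb₀ x).cexp.mul continuousWithinAt_const)
  rw [norm_mul, Complex.norm_exp]
  exact mul_le_of_le_one_left (norm_nonneg _) (Real.exp_le_one_iff.2 (hre b hb x))

theorem ofReal_div_mem_slitPlane {r : ℝ} (hr : 0 < r) {b : ℂ} (hb : b ≠ 0) (hre : 0 ≤ b.re) :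
    (r : ℂ) / b ∈ Complex.slitPlane := by
  have hsq : 0 < Complex.normSq b := Complex.normSq_pos.2 hb
  rw [Complex.mem_slitPlane_iff, div_eq_mul_inv, Complex.re_ofReal_mul, Complex.im_ofReal_mul,
    Complex.inv_re, Complex.inv_im]
  rcases hre.lt_or_eq with hpos | hzero
  · exact Or.inl (by positivity)
  · have him : b.im ≠ 0 := fun him => hb (Complex.ext hzero.symm him)
    exact Or.inr (mul_ne_zero hr.ne' (div_ne_zero (neg_ne_zero.2 him) hsq.ne'))

theorem integral_fresnel_mul_fourier {f : V → ℂ} (hf : Integrable f) (hFf : Integrable (𝓕 f))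
    {b : ℂ} (hb : b ≠ 0) (hre : 0 ≤ b.re) (y : V) :
    ∫ ξ, Complex.exp (-b * ‖ξ‖ ^ 2 + 2 * Real.pi * Complex.I * inner ℝ y ξ) * 𝓕 f ξ =
      (Real.pi / b) ^ (Module.finrank ℝ V / 2 : ℂ) *
        ∫ x, Complex.exp (-Real.pi ^ 2 * ‖y - x‖ ^ 2 / b) * f x := by
  set S : Set ℂ := {b | 0 < b.re}
  have hbS : (𝓝[S] b).NeBot := by
    rw [← mem_closure_iff_nhdsWithin_neBot, Complex.closure_setOfPred_lt_re]
    exact hre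
  have hdiv (c : ℂ) : ContinuousAt (fun b : ℂ => c / b) b :=
    continuousAt_const.div continuousAt_id hb
  have hre_left (b : ℂ) (hb : b ∈ S) (ξ : V) :
      (-b * ‖ξ‖ ^ 2 + 2 * Real.pi * Complex.I * inner ℝ y ξ).re ≤ 0 := by
    have h : 0 ≤ b.re * ‖ξ‖ ^ 2 := mul_nonneg (le_of_lt hb) (sq_nonneg _)
    simpa [← Complex.ofReal_pow] using h
  have hre_right (b : ℂ) (hb : b ∈ S) (x : V) :
      (-Real.pi ^ 2 * ‖y - x‖ ^ 2 / b : ℂ).re ≤ 0 := by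
    have h : 0 ≤ Real.pi ^ 2 * ‖y - x‖ ^ 2 * b.re / Complex.normSq b :=
      div_nonneg (mul_nonneg (by positivity) (le_of_lt hb)) (Complex.normSq_nonneg b)
    simpa [← Complex.ofReal_pow, Complex.div_re, neg_div] using h
  have hleft := continuousWithinAt_integral_cexp_mul hFf (b₀ := b) (fun _ _ => by fun_prop)
    hre_left (fun _ => by fun_prop)
  have hright := continuousWithinAt_integral_cexp_mul hf (b₀ := b) (fun _ _ => by fun_prop)
    hre_right (fun _ => (hdiv _).continuousWithinAt)
  have hpow : ContinuousWithinAt (fun b : ℂ => (Real.pi / b) ^ (Module.finrank ℝ V / 2 : ℂ)) S b :=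
    ((hdiv _).cpow continuousAt_const
      (ofReal_div_mem_slitPlane Real.pi_pos hb hre)).continuousWithinAt
  refine tendsto_nhds_unique_of_eventuallyEq hleft (hpow.mul hright) ?_
  filter_upwards [self_mem_nhdsWithin] with b' hb'
  exact integral_gaussian_mul_fourier hf hb' y

theorem integral_mul_fourier_smul {f g : V → ℂ} (hf : Integrable f) (hg : Integrable g) (r : ℝ) :
    ∫ x, f x * 𝓕 g (r • x) = ∫ x, 𝓕 f (r • x) * g x := by
  have hL : Continuous fun p : V × V => (r • innerₗ V) p.1 p.2 := continuous_inner.const_smul r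
  have hr (g : V → ℂ) (x : V) :
      VectorFourier.fourierIntegral Real.fourierChar volume (r • innerₗ V) g x = 𝓕 g (r • x) := by
    simp [VectorFourier.fourierIntegral, Real.fourier_eq, inner_smul_right]
  have hflip : (r • innerₗ V).flip = r • innerₗ V := by
    ext x y
    simp [real_inner_comm]
  have h := VectorFourier.integral_fourierIntegral_smul_eq_flip (L := r • innerₗ V)
    Real.continuous_fourierChar hL hf hg
  simpa only [hflip, hr, smul_eq_mul] using! h.symm

theorem integral_cexp_norm_sub_sq_mul (f : V → ℂ) (t : ℝ) (y : V) :
    ∫ x, Complex.exp ((‖y - x‖ ^ 2 / (4 * t) : ℝ) * Complex.I) * f x =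
      chirp (1 / (4 * t)) (fun y => 𝓕 (chirp (1 / (4 * t)) f) ((4 * Real.pi * t)⁻¹ • y)) y := by
  simp only [chirp, Real.fourier_eq', smul_eq_mul]
  rw [← integral_const_mul]
  refine integral_congr_ae (ae_of_all _ fun x => ?_)
  simp only [← mul_assoc, ← Complex.exp_add, ← add_mul, ← Complex.ofReal_add]
  congr 4
  rw [norm_sub_sq_real, inner_smul_right, real_inner_comm]
  field_simp
  ring

theorem fourier_schrodingerPhase_neg_mul_fourierInv (φ : 𝓢(V, ℂ)) {t : ℝ} (ht : t ≠ 0) (y : V) :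
    𝓕 (fun ξ => schrodingerPhase (-t) ξ * (𝓕⁻ φ : 𝓢(V, ℂ)) ξ) y =
      fresnelConst (Module.finrank ℝ V) t *
        chirp (1 / (4 * t)) (fun y => 𝓕 (chirp (1 / (4 * t)) φ) ((4 * Real.pi * t)⁻¹ • y)) y := by
  rw [← integral_cexp_norm_sub_sq_mul]
  have hint : Integrable (𝓕 (φ : V → ℂ)) := by
    rw [← SchwartzMap.fourier_coe]
    exact (𝓕 φ).integrable
  have hb : ((2 * Real.pi) ^ 2 * t * Complex.I : ℂ) ≠ 0 := by simp [ht, Real.pi_ne_zero]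
  have hre : 0 ≤ ((2 * Real.pi) ^ 2 * t * Complex.I : ℂ).re := by
    simp [← Complex.ofReal_pow, ← Complex.ofReal_ofNat, ← Complex.ofReal_mul]
  have h := integral_fresnel_mul_fourier φ.integrable hint hb hre y
  calc 𝓕 (fun ξ => schrodingerPhase (-t) ξ * (𝓕⁻ φ : 𝓢(V, ℂ)) ξ) y
      = 𝓕⁻ (fun ξ => schrodingerPhase (-t) ξ * 𝓕 (φ : V → ℂ) ξ) y := by
        rw [Real.fourier_eq', Real.fourierInv_eq', ← integral_neg_eq_self]
        refine integral_congr_ae (ae_of_all _ fun ξ => ?_)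
        simp [schrodingerPhase, SchwartzMap.fourierInv_coe, Real.fourierInv_eq_fourier_neg]
    _ = ∫ ξ, Complex.exp (-((2 * Real.pi) ^ 2 * t * Complex.I) * ‖ξ‖ ^ 2
          + 2 * Real.pi * Complex.I * inner ℝ y ξ) * 𝓕 (φ : V → ℂ) ξ := by
        rw [Real.fourierInv_eq']
        refine integral_congr_ae (ae_of_all _ fun ξ => ?_)
        simp only [schrodingerPhase, smul_eq_mul]
        rw [← mul_assoc, ← Complex.exp_add, real_inner_comm]
        congr 2
        push_cast
        ring
    _ = _ := by
        rw [h, fresnelConst]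
        congr 1
        refine integral_congr_ae (ae_of_all _ fun x => ?_)
        beta_reduce
        congr 2
        push_cast
        field_simp
        rw [Complex.I_sq]
        ring

end FresnelKernel

section Dilation

theorem eLpNorm_two_comp_inv_smul {V : Type*} [NormedAddCommGroup V] [NormedSpace ℝ V]
    [FiniteDimensional ℝ V] [MeasurableSpace V] [BorelSpace V] (μ : Measure V) [μ.IsAddHaarMeasure]
    {r : ℝ} (hr : 0 < r) (F : V → ℂ) :
    eLpNorm (fun x => F (r⁻¹ • x)) 2 μ =
      ENNReal.ofReal (r ^ ((Module.finrank ℝ V : ℝ) / 2)) * eLpNorm F 2 μ := by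
  have hr' : r⁻¹ ≠ 0 := (inv_pos.2 hr).ne'
  have h := (measurableEmbedding_const_smul₀ (α := V) hr').eLpNorm_map_measure (μ := μ) (p := 2)
    (g := F)
  rw [Measure.map_addHaar_smul μ hr', eLpNorm_smul_measure_of_ne_top ENNReal.ofNat_ne_top,
    inv_pow, inv_inv, abs_of_pos (pow_pos hr _), ENNReal.ofReal_rpow_of_pos (pow_pos hr _),
    ← Real.rpow_natCast_mul hr.le] at h
  simpa [Function.comp_def, div_eq_mul_inv] using h.symm

variable {n : ℕ}

theorem expWeightNorm_congr_ae (w : Rn n → ℝ) {f g : Rn n → ℂ} (h : f =ᵐ[volume] g) :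
    expWeightNorm w f = expWeightNorm w g :=
  eLpNorm_congr_ae (h.mono fun x hx => by simp only [hx])

theorem expWeightNorm_congr_norm (w : Rn n → ℝ) {f g : Rn n → ℂ} (h : ∀ x, ‖f x‖ = ‖g x‖) :
    expWeightNorm w f = expWeightNorm w g :=
  eLpNorm_congr_norm_ae (ae_of_all _ fun x => by rw [norm_mul, norm_mul, h])

theorem expWeightNorm_dilation {r : ℝ} (hr : 0 < r) {c : ℂ} (hc : ‖c‖ = r ^ (-(n : ℝ) / 2))
    (w : Rn n → ℝ) (F : Rn n → ℂ) :
    expWeightNorm w (fun x => c * F (r⁻¹ • x)) = expWeightNorm (fun ξ => w (r • ξ)) F := by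
  set G : Rn n → ℂ := fun ξ => Real.exp (w (r • ξ)) * F ξ
  have hG : (fun x => (Real.exp (w x) : ℂ) * (c * F (r⁻¹ • x))) = c • fun x => G (r⁻¹ • x) := by
    funext x
    simp only [G, smul_inv_smul₀ hr.ne', Pi.smul_apply, smul_eq_mul, mul_left_comm]
  rw [expWeightNorm, hG, eLpNorm_const_smul, eLpNorm_two_comp_inv_smul volume hr, ← mul_assoc,
    ← ofReal_norm, hc, ← ENNReal.ofReal_mul (by positivity), ← Real.rpow_add hr,
    finrank_euclideanSpace_fin, neg_div, neg_add_cancel, Real.rpow_zero, ENNReal.ofReal_one,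
    one_mul, expWeightNorm]

theorem expWeightNorm_fourierHat (w : Rn n → ℝ) (f : L2Rn n) :
    expWeightNorm w (fourierHat f) =
      expWeightNorm (fun ξ => w ((2 * Real.pi) • ξ)) (𝓕 f : L2Rn n) :=
  expWeightNorm_dilation Real.two_pi_pos
    (by rw [Complex.norm_real, Real.norm_of_nonneg (by positivity)]) w _

end Dilation

namespace IsFreeSchrodingerSolution

variable {n : ℕ} {u₀ : L2Rn n} {u : ℝ → L2Rn n}

theorem fourier_ae_eq (hu : IsFreeSchrodingerSolution u₀ u) {t : ℝ} (ht : 0 ≤ t) :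
    ∀ᵐ ξ, (𝓕 (u t) : L2Rn n) ξ = schrodingerPhase (-t) ξ * (𝓕 u₀ : L2Rn n) ξ := by
  filter_upwards [hu.schrodingerPhase_mul_fourier_ae_eq ht] with ξ hξ
  rw [hu.initial] at hξ
  rw [← hξ, ← mul_assoc, schrodingerPhase, schrodingerPhase, ← Complex.exp_add]
  simp

theorem eLpNorm_eq (hu : IsFreeSchrodingerSolution u₀ u) {t : ℝ} (ht : 0 ≤ t) :
    eLpNorm (u t) 2 volume = eLpNorm u₀ 2 volume := by
  rw [← eLpNorm_fourier_L2, ← eLpNorm_fourier_L2 u₀]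
  refine eLpNorm_congr_norm_ae ?_
  filter_upwards [hu.fourier_ae_eq ht] with ξ hξ
  rw [hξ, norm_mul, norm_schrodingerPhase, one_mul]

theorem integral_schwartz_mul_eq (hu : IsFreeSchrodingerSolution u₀ u) {t : ℝ} (ht : 0 ≤ t)
    (φ : 𝓢(Rn n, ℂ)) :
    ∫ x, φ x * u t x =
      ∫ y, 𝓕 (fun ξ => schrodingerPhase (-t) ξ * (𝓕⁻ φ : 𝓢(Rn n, ℂ)) ξ) y * u₀ y := by
  set ψ : 𝓢(Rn n, ℂ) := 𝓕⁻ φ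
  set m : Rn n → ℂ := fun ξ => schrodingerPhase (-t) ξ * ψ ξ
  have hm : AEStronglyMeasurable m :=
    (contDiff_schrodingerPhase (-t)).continuous.aestronglyMeasurable.mul
      ψ.continuous.aestronglyMeasurable
  have hnorm (ξ : Rn n) : ‖m ξ‖ = ‖ψ ξ‖ := by rw [norm_mul, norm_schrodingerPhase, one_mul]
  have hm₁ : Integrable m :=
    ψ.integrable.congr' hm (ae_of_all _ fun ξ => (hnorm ξ).symm)
  have hm₂ : MemLp m 2 :=
    (ψ.memLp 2 volume).congr_norm hm (ae_of_all _ fun ξ => (hnorm ξ).symm)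
  calc ∫ x, φ x * u t x = ∫ ξ, ψ ξ * (𝓕 (u t) : L2Rn n) ξ := by
        rw [integral_mul_fourier_schwartz, FourierInvPair.fourier_fourierInv_eq]
    _ = ∫ ξ, m ξ * (𝓕 u₀ : L2Rn n) ξ := by
        refine integral_congr_ae ?_
        filter_upwards [hu.fourier_ae_eq ht] with ξ hξ
        rw [hξ, mul_left_comm, ← mul_assoc]
    _ = ∫ y, 𝓕 m y * u₀ y := integral_mul_fourier_L2 hm₁ hm₂ u₀

theorem ae_eq_chirp_fourier_chirp (hu : IsFreeSchrodingerSolution u₀ u) (hu₀ : Integrable u₀)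
    {t : ℝ} (ht : 0 < t) :
    u t =ᵐ[volume] fun x => fresnelConst n t *
      chirp (1 / (4 * t)) (fun y => 𝓕 (chirp (1 / (4 * t)) u₀) ((4 * Real.pi * t)⁻¹ • y)) x := by
  set s := 1 / (4 * t)
  set r := (4 * Real.pi * t)⁻¹
  have hcont : Continuous fun x => chirp s (fun y => 𝓕 (chirp s u₀) (r • y)) x := by
    have h := continuous_fourier_of_integrable (integrable_chirp s hu₀)
    unfold chirp
    fun_prop
  refine ae_eq_of_integral_schwartz_mul_eq ((Lp.memLp _).locallyIntegrable one_le_two)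
    (continuous_const.mul hcont).locallyIntegrable fun φ _ => ?_
  calc ∫ x, φ x * u t x
      = fresnelConst n t * ∫ y, chirp s u₀ y * 𝓕 (chirp s φ) (r • y) := by
        rw [hu.integral_schwartz_mul_eq ht.le, ← integral_const_mul]
        refine integral_congr_ae (ae_of_all _ fun y => ?_)
        beta_reduce
        rw [fourier_schrodingerPhase_neg_mul_fourierInv φ ht.ne', finrank_euclideanSpace_fin]
        simp only [chirp]
        ring
    _ = fresnelConst n t * ∫ x, 𝓕 (chirp s u₀) (r • x) * chirp s φ x := by
        rw [integral_mul_fourier_smul (integrable_chirp s hu₀) (integrable_chirp s φ.integrable)]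
    _ = _ := by
        rw [← integral_const_mul]
        refine integral_congr_ae (ae_of_all _ fun x => ?_)
        simp only [chirp]
        ring

theorem expWeightNorm_eq (hu : IsFreeSchrodingerSolution u₀ u) (hu₀ : Integrable u₀)
    {t : ℝ} (ht : 0 < t) (w : Rn n → ℝ) :
    expWeightNorm w (u t) =
      expWeightNorm (fun ξ => w ((4 * Real.pi * t) • ξ)) (𝓕 (chirp (1 / (4 * t)) u₀)) := by
  have hr : 0 < 4 * Real.pi * t := by positivity
  have hc : ‖fresnelConst n t‖ = (4 * Real.pi * t) ^ (-(n : ℝ) / 2) := by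
    rw [norm_fresnelConst n ht, Real.inv_rpow hr.le, neg_div, Real.rpow_neg hr.le]
  rw [expWeightNorm_congr_ae w (hu.ae_eq_chirp_fourier_chirp hu₀ ht),
    ← expWeightNorm_dilation hr hc]
  exact expWeightNorm_congr_norm w fun x => by rw [norm_mul, norm_mul, norm_chirp]

end IsFreeSchrodingerSolution

section EntireFunctions

open Filter Topology

/-- Cauchy's estimate turns the dominating function of `Φ` into one of its complex derivative. -/
theorem differentiable_integral_of_dominated {X : Type*} [MeasurableSpace X] {μ : Measure X}
    {Φ : ℂ → X → ℂ} (hm : ∀ z, AEStronglyMeasurable (Φ z) μ)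
    (hd : ∀ x, Differentiable ℂ (fun z => Φ z x))
    (hb : ∀ R : ℝ, ∃ b : X → ℝ, Integrable b μ ∧ ∀ z, ‖z‖ ≤ R → ∀ x, ‖Φ z x‖ ≤ b x) :
    Differentiable ℂ (fun z => ∫ x, Φ z x ∂μ) := by
  intro z₀
  obtain ⟨b, hbi, hb⟩ := hb (‖z₀‖ + 2)
  have hmeas : AEStronglyMeasurable (fun x => deriv (fun z => Φ z x) z₀) μ := by
    have hslope (t : ℂ) : AEStronglyMeasurable (fun x => slope (fun z => Φ z x) z₀ t) μ :=
      (((hm t).sub (hm z₀)).const_mul (t - z₀)⁻¹).congr (ae_of_all _ fun x => by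
        simp [slope_def_module])
    exact aestronglyMeasurable_of_tendsto_ae (𝓝[≠] z₀) hslope (ae_of_all _ fun x =>
      hasDerivAt_iff_tendsto_slope.1 ((hd x) z₀).hasDerivAt)
  have hderiv (x : X) {z : ℂ} (hz : z ∈ Metric.ball z₀ 1) :
      ‖deriv (fun z => Φ z x) z‖ ≤ b x := by
    have h := Complex.norm_deriv_le_of_forall_mem_sphere_norm_le (c := z) (C := b x)
      (f := fun z => Φ z x) one_pos (hd x).diffContOnCl fun w hw => hb w ?_ x
    · simpa using h
    · rw [mem_sphere_iff_norm] at hw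
      rw [mem_ball_iff_norm] at hz
      have hw' := norm_add₃_le (a := w - z) (b := z - z₀) (c := z₀)
      rw [sub_add_sub_cancel, sub_add_cancel] at hw'
      linarith
  exact (hasDerivAt_integral_of_dominated_loc_of_deriv_le (bound := b)
    (F' := fun z x => deriv (fun z => Φ z x) z) (Metric.ball_mem_nhds z₀ one_pos)
    (Eventually.of_forall hm)
    (hbi.mono' (hm z₀) (ae_of_all _ fun x => hb z₀ (by linarith) x)) hmeas
    (ae_of_all _ fun x z hz => hderiv x hz) hbi
    (ae_of_all _ fun x z _ => ((hd x) z).hasDerivAt)).2.differentiableAt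

theorem eq_of_forall_eq_ofReal_mul_I {F G : ℂ → ℂ} (hF : Differentiable ℂ F)
    (hG : Differentiable ℂ G) (h : ∀ y : ℝ, F (y * Complex.I) = G (y * Complex.I)) : F = G := by
  refine AnalyticOnNhd.eq_of_frequently_eq (z₀ := 0)
    (fun z _ => hF.analyticAt z) (fun z _ => hG.analyticAt z) ?_
  have hlim : Tendsto (fun y : ℝ => (y : ℂ) * Complex.I) (𝓝[≠] 0) (𝓝[≠] 0) := by
    refine tendsto_nhdsWithin_iff.2 ⟨?_, ?_⟩
    · have hcont : Continuous (fun y : ℝ => (y : ℂ) * Complex.I) := by fun_prop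
      simpa using (hcont.tendsto 0).mono_left (nhdsWithin_le_nhds (s := {0}ᶜ))
    · filter_upwards [self_mem_nhdsWithin] with y hy
      simpa using hy
  exact hlim.frequently (Frequently.of_forall h)

theorem norm_le_rpow_mul_rpow_of_exp_growth {F : ℂ → ℂ} (hF : Differentiable ℂ F) {K A B c θ : ℝ}
    (hK : ∀ z : ℂ, z.re ∈ Ioo (0 : ℝ) 1 → ‖F z‖ ≤ K * Real.exp (c * |z.im|))
    (hA : ∀ z : ℂ, z.re = 0 → ‖F z‖ ≤ A) (hB : ∀ z : ℂ, z.re = 1 → ‖F z‖ ≤ B)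
    (hθ : θ ∈ Icc (0 : ℝ) 1) : ‖F θ‖ ≤ A ^ (1 - θ) * B ^ θ := by
  have hgrowth : F =O[comap (_root_.abs ∘ Complex.im) atTop ⊓ 𝓟 (Complex.re ⁻¹' Ioo 0 1)]
      fun z => Real.exp (|c| * Real.exp (1 * |z.im|)) := by
    refine Asymptotics.IsBigO.of_bound K (eventually_inf_principal.2 (.of_forall fun z hz => ?_))
    have hexp : c * |z.im| ≤ |c| * Real.exp (1 * |z.im|) := by
      gcongr
      · exact le_abs_self c
      · linarith [Real.add_one_le_exp (1 * |z.im|)]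
    have hK₀ : 0 ≤ K :=
      nonneg_of_mul_nonneg_left ((norm_nonneg _).trans (hK z hz)) (Real.exp_pos _)
    rw [Real.norm_of_nonneg (Real.exp_pos _).le]
    exact (hK z hz).trans (by gcongr)
  have hbdd : BddAbove (norm ∘ F '' Complex.HadamardThreeLines.verticalClosedStrip 0 1) := by
    refine ⟨max A B, ?_⟩
    rintro _ ⟨z, hz, rfl⟩
    exact PhragmenLindelof.vertical_strip hF.diffContOnCl
      ⟨1, by linarith [Real.pi_gt_three], |c|, hgrowth⟩
      (fun z hz => (hA z hz).trans (le_max_left _ _))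
      (fun z hz => (hB z hz).trans (le_max_right _ _)) hz.1 hz.2
  simpa using Complex.HadamardThreeLines.norm_le_interp_of_mem_verticalClosedStrip₀₁' F
    (z := (θ : ℂ)) (by simpa [Complex.HadamardThreeLines.verticalClosedStrip] using hθ)
    hF.diffContOnCl hbdd hA hB

/-- Hadamard's three lines theorem with an exponential factor on the right line: the factor
`e^{-icz²/2}` has modulus `1` on `Re z = 0`, `e^{c Im z}` on `Re z = 1` and `1` on the real axis.
It is unbounded in the strip, so boundedness comes from Phragmén–Lindelöf. -/
theorem norm_le_rpow_mul_rpow_of_strip {G : ℂ → ℂ} (hG : Differentiable ℂ G) {K A B c θ : ℝ}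
    (hK : ∀ z : ℂ, z.re ∈ Icc (0 : ℝ) 1 → ‖G z‖ ≤ K)
    (hA : ∀ y : ℝ, ‖G (y * Complex.I)‖ ≤ A)
    (hB : ∀ y : ℝ, ‖G (1 + y * Complex.I)‖ ≤ Real.exp (-c * y) * B)
    (hθ : θ ∈ Icc (0 : ℝ) 1) : ‖G θ‖ ≤ A ^ (1 - θ) * B ^ θ := by
  set E : ℂ → ℂ := fun z => Complex.exp (-(c / 2 : ℝ) * Complex.I * z ^ 2)
  have hE (z : ℂ) : ‖E z‖ = Real.exp (c * z.re * z.im) := by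
    rw [Complex.norm_exp]
    simp only [Complex.mul_re, Complex.mul_im, Complex.neg_re, Complex.neg_im, Complex.ofReal_re,
      Complex.ofReal_im, Complex.I_re, Complex.I_im, sq]
    ring_nf
  have hleft (z : ℂ) (hz : z.re = 0) : ‖G z * E z‖ ≤ A := by
    have hz' : (z.im : ℂ) * Complex.I = z := by simpa [hz] using Complex.re_add_im z
    simpa [norm_mul, hE, hz, hz'] using hA z.im
  have hright (z : ℂ) (hz : z.re = 1) : ‖G z * E z‖ ≤ B := by
    have hz' : 1 + (z.im : ℂ) * Complex.I = z := by simpa [hz] using Complex.re_add_im z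
    have h := hB z.im
    rwa [hz', neg_mul, Real.exp_neg, ← div_eq_inv_mul, le_div_iff₀ (Real.exp_pos _),
      ← mul_one c, ← hz, ← hE, ← norm_mul] at h
  have hgrowth (z : ℂ) (hz : z.re ∈ Ioo (0 : ℝ) 1) : ‖G z * E z‖ ≤ K * Real.exp (|c| * |z.im|) := by
    have hexp : c * z.re * z.im ≤ |c| * |z.im| := calc
      c * z.re * z.im ≤ |c| * z.re * |z.im| := by
        rw [← abs_of_pos hz.1, ← abs_mul, ← abs_mul, abs_of_pos hz.1]
        exact le_abs_self _
      _ ≤ |c| * |z.im| := by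
        gcongr
        exact mul_le_of_le_one_right (abs_nonneg c) hz.2.le
    have hGK := hK z (Ioo_subset_Icc_self hz)
    have hK₀ := (norm_nonneg _).trans hGK
    rw [norm_mul, hE]
    gcongr
  have hGE : Differentiable ℂ (fun z => G z * E z) := by fun_prop
  simpa [norm_mul, hE] using
    norm_le_rpow_mul_rpow_of_exp_growth hGE hgrowth hleft hright hθ

end EntireFunctions

section Decay

variable {V : Type*} [NormedAddCommGroup V]

/-- Functions that lie in `L²` after multiplication by any exponential `e^{c|x|}`. -/
def SuperExpDecay [MeasureSpace V] (f : V → ℂ) : Prop :=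
  ∀ c : ℝ, MemLp (fun x => (Real.exp (c * ‖x‖) : ℂ) * f x) 2

theorem memLp_exp_neg_norm [NormedSpace ℝ V] [FiniteDimensional ℝ V] [MeasurableSpace V]
    [BorelSpace V] (μ : Measure V) [μ.IsAddHaarMeasure] :
    MemLp (fun x : V => (Real.exp (-‖x‖) : ℂ)) 2 μ := by
  set k := Module.finrank ℝ V + 1
  have hcont : Continuous fun x : V => (Real.exp (-‖x‖) : ℂ) := by fun_prop
  rw [memLp_two_iff_integrable_sq_norm hcont.aestronglyMeasurable]
  have hint : Integrable (fun x : V => (1 + ‖x‖) ^ (-(k : ℝ))) μ :=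
    integrable_one_add_norm (by simp [k])
  refine (hint.const_mul (Real.exp 2 * k.factorial)).mono'
    (Continuous.aestronglyMeasurable (by fun_prop)) (ae_of_all _ fun x => ?_)
  have hx : 0 < 1 + ‖x‖ := by positivity
  have hpow := Real.pow_div_factorial_le_exp (1 + ‖x‖) hx.le k
  have hle : (1 + ‖x‖) ^ k / k.factorial ≤ Real.exp (2 * (1 + ‖x‖)) :=
    hpow.trans (Real.exp_le_exp.2 (by linarith))
  rw [Real.norm_of_nonneg (sq_nonneg _), Complex.norm_real, Real.norm_of_nonneg (Real.exp_pos _).le,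
    ← Real.exp_nat_mul, Real.rpow_neg hx.le, Real.rpow_natCast]
  have hexp : Real.exp ((2 : ℕ) * -‖x‖) = Real.exp 2 * (Real.exp (2 * (1 + ‖x‖)))⁻¹ := by
    rw [← Real.exp_neg, ← Real.exp_add]
    push_cast
    ring_nf
  rw [hexp, mul_assoc, ← div_eq_mul_inv (k.factorial : ℝ), ← inv_div]
  gcongr

variable [InnerProductSpace ℝ V]

theorem norm_cexp_inner_mul_le (f : V → ℂ) {R : ℝ} (v : V) {z : ℂ} (hz : |z.re| ≤ R) (x : V) :
    ‖Complex.exp (z * inner ℝ v x) * f x‖ ≤ ‖(Real.exp (R * ‖v‖ * ‖x‖) : ℂ) * f x‖ := by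
  rw [norm_mul, norm_mul]
  gcongr
  rw [Complex.norm_exp, Complex.norm_real, Real.norm_of_nonneg (Real.exp_pos _).le,
    Complex.re_mul_ofReal]
  refine Real.exp_le_exp.2 ((le_abs_self _).trans ?_)
  rw [abs_mul, mul_assoc]
  exact mul_le_mul hz (abs_real_inner_le_norm v x) (abs_nonneg _) ((abs_nonneg _).trans hz)

variable [FiniteDimensional ℝ V] [MeasurableSpace V] [BorelSpace V] {f : V → ℂ}

theorem superExpDecay_of_memLp_exp_sq (hf : AEStronglyMeasurable f) (a : V) {r : ℝ} (hr : 0 < r)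
    (h : MemLp (fun x => (Real.exp (‖x + a‖ ^ 2 / r ^ 2) : ℂ) * f x) 2) : SuperExpDecay f := by
  intro c
  refine h.of_le_mul (c := Real.exp (c ^ 2 * r ^ 2 + |c| * ‖a‖))
    ((Continuous.aestronglyMeasurable (by fun_prop)).mul hf) (ae_of_all _ fun x => ?_)
  rw [norm_mul, norm_mul, ← mul_assoc]
  gcongr
  rw [Complex.norm_real, Complex.norm_real, Real.norm_of_nonneg (Real.exp_pos _).le,
    Real.norm_of_nonneg (Real.exp_pos _).le, ← Real.exp_add]
  refine Real.exp_le_exp.2 ?_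
  have hx : ‖x‖ ≤ ‖x + a‖ + ‖a‖ := by simpa using norm_sub_le (x + a) a
  have hcx : c * ‖x‖ ≤ |c| * ‖x + a‖ + |c| * ‖a‖ := by
    rw [← mul_add]
    exact mul_le_mul (le_abs_self c) hx (norm_nonneg _) (abs_nonneg c)
  have hamgm : |c| * ‖x + a‖ ≤ c ^ 2 * r ^ 2 + ‖x + a‖ ^ 2 / r ^ 2 := by
    rw [← sq_abs c, ← mul_pow, ← div_pow]
    have : |c| * ‖x + a‖ = (|c| * r) * (‖x + a‖ / r) := by field_simp
    nlinarith [sq_nonneg (|c| * r - ‖x + a‖ / r), sq_nonneg (|c| * r), sq_nonneg (‖x + a‖ / r)]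
  linarith

theorem SuperExpDecay.memLp (hf : SuperExpDecay f) : MemLp f 2 := by
  simpa using hf 0

theorem SuperExpDecay.aestronglyMeasurable (hf : SuperExpDecay f) : AEStronglyMeasurable f :=
  hf.memLp.1

theorem SuperExpDecay.integrable_exp_norm_mul (hf : SuperExpDecay f) (c : ℝ) :
    Integrable (fun x => (Real.exp (c * ‖x‖) : ℂ) * f x) := by
  refine ((memLp_exp_neg_norm volume).integrable_mul (hf (c + 1))).congr (ae_of_all _ fun x => ?_)
  rw [Pi.mul_apply, ← mul_assoc, ← Complex.ofReal_mul, ← Real.exp_add]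
  ring_nf

theorem SuperExpDecay.integrable (hf : SuperExpDecay f) : Integrable f := by
  simpa using hf.integrable_exp_norm_mul 0

theorem SuperExpDecay.chirp (hf : SuperExpDecay f) (s : ℝ) : SuperExpDecay (chirp s f) :=
  fun c => (hf c).congr_norm
    ((Continuous.aestronglyMeasurable (by fun_prop)).mul
      (aestronglyMeasurable_chirp s hf.aestronglyMeasurable))
    (ae_of_all _ fun x => by rw [norm_mul, norm_mul, norm_chirp])

theorem SuperExpDecay.comp_sub_right (hf : SuperExpDecay f) (w : V) :
    SuperExpDecay (fun x => f (x - w)) := by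
  intro c
  have hmp := measurePreserving_sub_right (volume : Measure V) w
  have hmem := (hf |c|).comp_measurePreserving hmp
  refine hmem.of_le_mul (c := Real.exp (|c| * ‖w‖))
    ((Continuous.aestronglyMeasurable (by fun_prop)).mul
      (hf.aestronglyMeasurable.comp_measurePreserving hmp)) (ae_of_all _ fun x => ?_)
  simp only [Function.comp_apply, norm_mul, Complex.norm_real,
    Real.norm_of_nonneg (Real.exp_pos _).le]
  rw [← mul_assoc, ← Real.exp_add, ← mul_add]
  gcongr
  · exact le_abs_self c
  · simpa [add_comm] using norm_add_le (x - w) w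

theorem SuperExpDecay.aestronglyMeasurable_cexp_inner_mul (hf : SuperExpDecay f) (v : V) (z : ℂ) :
    AEStronglyMeasurable (fun x => Complex.exp (z * inner ℝ v x) * f x) :=
  (Continuous.aestronglyMeasurable (by fun_prop)).mul hf.aestronglyMeasurable

theorem SuperExpDecay.integrable_cexp_inner_mul (hf : SuperExpDecay f) (v : V) (z : ℂ) :
    Integrable (fun x => Complex.exp (z * inner ℝ v x) * f x) :=
  (hf.integrable_exp_norm_mul _).mono (hf.aestronglyMeasurable_cexp_inner_mul v z)
    (ae_of_all _ fun x => norm_cexp_inner_mul_le f v le_rfl x)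

theorem SuperExpDecay.memLp_cexp_inner_mul (hf : SuperExpDecay f) (v : V) (z : ℂ) :
    MemLp (fun x => Complex.exp (z * inner ℝ v x) * f x) 2 :=
  (hf _).mono (hf.aestronglyMeasurable_cexp_inner_mul v z)
    (ae_of_all _ fun x => norm_cexp_inner_mul_le f v le_rfl x)

theorem SuperExpDecay.differentiable_integral_cexp_inner_mul (hf : SuperExpDecay f) (v : V)
    {g : V → ℂ} (hg : MemLp g 2) :
    Differentiable ℂ (fun z => ∫ x, Complex.exp (z * inner ℝ v x) * f x * g x) := by
  refine differentiable_integral_of_dominated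
    (fun z => (hf.aestronglyMeasurable_cexp_inner_mul v z).mul hg.1) (fun x => by fun_prop)
    fun R => ⟨_, ((hf (R * ‖v‖)).integrable_mul hg).norm, fun z hz x => ?_⟩
  rw [Pi.mul_apply, norm_mul, norm_mul _ (g x)]
  gcongr
  exact norm_cexp_inner_mul_le f v ((Complex.abs_re_le_norm z).trans hz) x

end Decay

section ExpFourier

variable {V : Type*} [NormedAddCommGroup V] [InnerProductSpace ℝ V] [FiniteDimensional ℝ V]
  [MeasurableSpace V] [BorelSpace V]

/-- The Fourier transform of `e^{z⟨v,x⟩} f`, that is, the Fourier–Laplace transform of `f` along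
the complex direction `v`. -/
noncomputable def expFourier (f : V → ℂ) (v : V) (z : ℂ) : V → ℂ :=
  𝓕 (fun x => Complex.exp (z * inner ℝ v x) * f x)

theorem expFourier_zero (f : V → ℂ) (v : V) : expFourier f v 0 = 𝓕 f := by
  simp [expFourier]

theorem expFourier_apply (f : V → ℂ) (v : V) (z : ℂ) (ξ : V) :
    expFourier f v z ξ = ∫ x, Complex.exp ((-2 * Real.pi * inner ℝ x ξ : ℝ) * Complex.I) *
      (Complex.exp (z * inner ℝ v x) * f x) := by
  simp only [expFourier, Real.fourier_eq', smul_eq_mul]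

theorem expFourier_add_mul_I (f : V → ℂ) (v : V) (z : ℂ) (y : ℝ) (ξ : V) :
    expFourier f v (z + y * Complex.I) ξ = expFourier f v z (ξ - (y / (2 * Real.pi)) • v) := by
  rw [expFourier_apply, expFourier_apply]
  refine integral_congr_ae (ae_of_all _ fun x => ?_)
  beta_reduce
  rw [← mul_assoc, ← mul_assoc, ← Complex.exp_add, ← Complex.exp_add]
  congr 2
  rw [inner_sub_right, inner_smul_right, real_inner_comm v x]
  push_cast
  field_simp
  ring

theorem expFourier_mul_I (f : V → ℂ) (v : V) (y : ℝ) (ξ : V) :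
    expFourier f v (y * Complex.I) ξ = 𝓕 f (ξ - (y / (2 * Real.pi)) • v) := by
  rw [← zero_add (y * Complex.I), expFourier_add_mul_I, expFourier_zero]

namespace SuperExpDecay

variable {f : V → ℂ}

theorem continuous_expFourier (hf : SuperExpDecay f) (v : V) (z : ℂ) :
    Continuous (expFourier f v z) :=
  continuous_fourier_of_integrable (hf.integrable_cexp_inner_mul v z)

theorem exists_norm_expFourier_le (hf : SuperExpDecay f) (v : V) (R : ℝ) :
    ∃ C : ℝ, ∀ z : ℂ, |z.re| ≤ R → ∀ ξ, ‖expFourier f v z ξ‖ ≤ C := by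
  refine ⟨∫ x, ‖(Real.exp (R * ‖v‖ * ‖x‖) : ℂ) * f x‖, fun z hz ξ => ?_⟩
  rw [expFourier_apply]
  refine norm_integral_le_of_norm_le (hf.integrable_exp_norm_mul _).norm (ae_of_all _ fun x => ?_)
  rw [norm_mul, Complex.norm_exp_ofReal_mul_I, one_mul]
  exact norm_cexp_inner_mul_le f v hz x

theorem differentiable_expFourier (hf : SuperExpDecay f) (v ξ : V) :
    Differentiable ℂ (fun z => expFourier f v z ξ) := by
  simp only [expFourier_apply]
  refine differentiable_integral_of_dominated (fun z => ?_) (fun x => by fun_prop) fun R =>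
    ⟨_, (hf.integrable_exp_norm_mul (R * ‖v‖)).norm, fun z hz x => ?_⟩
  · exact (Continuous.aestronglyMeasurable (by fun_prop)).mul
      (hf.aestronglyMeasurable_cexp_inner_mul v z)
  · rw [norm_mul, Complex.norm_exp_ofReal_mul_I, one_mul]
    exact norm_cexp_inner_mul_le f v ((Complex.abs_re_le_norm z).trans hz) x

end SuperExpDecay

end ExpFourier

section Duality

theorem eLpNorm_two_sq {X : Type*} [MeasurableSpace X] {μ : Measure X} (f : X → ℂ) :
    eLpNorm f 2 μ ^ 2 = ∫⁻ x, ‖f x‖ₑ ^ 2 ∂μ := by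
  simpa using eLpNorm_nnreal_pow_eq_lintegral (f := f) (μ := μ) (p := 2) two_ne_zero

theorem enorm_integral_mul_le_eLpNorm_mul_eLpNorm {X : Type*} [MeasurableSpace X] {μ : Measure X}
    {f g : X → ℂ} (hf : AEStronglyMeasurable f μ) (hg : AEStronglyMeasurable g μ) :
    ‖∫ x, f x * g x ∂μ‖ₑ ≤ eLpNorm f 2 μ * eLpNorm g 2 μ := by
  refine (enorm_integral_le_lintegral_enorm _).trans ?_
  rw [← eLpNorm_one_eq_lintegral_enorm]
  simpa only [smul_eq_mul, Pi.mul_def] using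
    eLpNorm_smul_le_mul_eLpNorm (p := 2) (q := 2) (r := 1) hg hf

theorem enorm_integral_mul_conj_self {X : Type*} [MeasurableSpace X] {μ : Measure X} {f : X → ℂ}
    (hf : MemLp f 2 μ) : ‖∫ x, f x * (starRingEnd ℂ) (f x) ∂μ‖ₑ = eLpNorm f 2 μ ^ 2 := by
  have hsq (x : X) : f x * (starRingEnd ℂ) (f x) = ((‖f x‖ ^ 2 : ℝ) : ℂ) := by
    rw [Complex.mul_conj, Complex.normSq_eq_norm_sq]
  simp only [hsq]
  rw [integral_complex_ofReal, ← ofReal_norm, Complex.norm_real,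
    Real.norm_of_nonneg (integral_nonneg fun x => sq_nonneg _),
    ofReal_integral_eq_lintegral_ofReal ((memLp_two_iff_integrable_sq_norm hf.1).1 hf)
      (ae_of_all _ fun x => sq_nonneg _), eLpNorm_two_sq]
  simp only [ENNReal.ofReal_pow (norm_nonneg _), ofReal_norm]

open Filter Topology in
theorem eLpNorm_le_of_forall_closedBall {V : Type*} [NormedAddCommGroup V] [MeasurableSpace V]
    [OpensMeasurableSpace V] {μ : Measure V} {p C : ℝ≥0∞} {f : V → ℂ}
    (hf : AEStronglyMeasurable f μ)
    (h : ∀ k : ℕ, eLpNorm ((Metric.closedBall 0 k).indicator f) p μ ≤ C) : eLpNorm f p μ ≤ C := by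
  refine Lp.eLpNorm_le_of_ae_tendsto (u := atTop) (Eventually.of_forall h)
    (fun k => hf.indicator measurableSet_closedBall) (ae_of_all _ fun x => ?_)
  refine tendsto_const_nhds.congr' ?_
  filter_upwards [eventually_ge_atTop ⌈‖x‖⌉₊] with k hk
  rw [indicator_of_mem (mem_closedBall_zero_iff.2 (Nat.ceil_le.1 hk))]

variable {V : Type*} [NormedAddCommGroup V] [InnerProductSpace ℝ V] [FiniteDimensional ℝ V]
  [MeasurableSpace V] [BorelSpace V]

theorem superExpDecay_indicator_closedBall {f : V → ℂ} (hf : Continuous f) (R : ℝ) :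
    SuperExpDecay ((Metric.closedBall 0 R).indicator f) := by
  intro c
  have hcont : Continuous fun x => (Real.exp (c * ‖x‖) : ℂ) * f x := by fun_prop
  have hmul : (fun x => (Real.exp (c * ‖x‖) : ℂ) * (Metric.closedBall 0 R).indicator f x) =
      (Metric.closedBall 0 R).indicator fun x => (Real.exp (c * ‖x‖) : ℂ) * f x :=
    funext fun x => (indicator_mul_right _ (fun x => (Real.exp (c * ‖x‖) : ℂ)) f).symm
  rw [hmul, memLp_indicator_iff_restrict measurableSet_closedBall,
    memLp_two_iff_integrable_sq_norm hcont.aestronglyMeasurable]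
  exact (hcont.norm.pow 2).continuousOn.integrableOn_compact (isCompact_closedBall 0 R)

theorem eLpNorm_le_of_forall_superExpDecay {f : V → ℂ} (hf : Continuous f) {C : ℝ≥0∞}
    (h : ∀ g : V → ℂ, SuperExpDecay g → ‖∫ x, f x * g x‖ₑ ≤ C * eLpNorm g 2) :
    eLpNorm f 2 ≤ C := by
  refine eLpNorm_le_of_forall_closedBall hf.aestronglyMeasurable fun k => ?_
  set fk := (Metric.closedBall (0 : V) k).indicator f
  set gk := (Metric.closedBall (0 : V) k).indicator fun x => (starRingEnd ℂ) (f x)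
  have hconj (x : V) : gk x = (starRingEnd ℂ) (fk x) := by
    by_cases hx : x ∈ Metric.closedBall (0 : V) k <;> simp [fk, gk, hx]
  have hmul (x : V) : f x * gk x = fk x * (starRingEnd ℂ) (fk x) := by
    by_cases hx : x ∈ Metric.closedBall (0 : V) k <;> simp [fk, gk, hx]
  have hnorm : eLpNorm gk 2 = eLpNorm fk 2 :=
    eLpNorm_congr_norm_ae (ae_of_all _ fun x => by rw [hconj, RCLike.norm_conj])
  have hfk : MemLp fk 2 := (superExpDecay_indicator_closedBall hf k).memLp
  have hle := h gk (superExpDecay_indicator_closedBall (by fun_prop) k)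
  simp only [hmul] at hle
  rw [enorm_integral_mul_conj_self hfk, hnorm, sq] at hle
  rcases eq_or_ne (eLpNorm fk 2) 0 with h0 | h0
  · rw [h0]
    exact zero_le
  · exact (ENNReal.mul_le_mul_iff_left h0 hfk.2.ne).1 hle

end Duality

section WeightPairing

variable {V : Type*} [NormedAddCommGroup V] [InnerProductSpace ℝ V] [FiniteDimensional ℝ V]
  [MeasurableSpace V] [BorelSpace V]

/-- The pairing of `e^{q⟨v,ξ⟩} 𝓕(e^{p⟨v,x⟩} f)` with a test function `g`. It is holomorphic in the
weights `p` and `q`. -/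
noncomputable def weightPairing (f : V → ℂ) (v : V) (g : V → ℂ) (p q : ℂ) : ℂ :=
  ∫ ξ, expFourier f v p ξ * (Complex.exp (q * inner ℝ v ξ) * g ξ)

variable {f g : V → ℂ}

theorem SuperExpDecay.exists_norm_weightPairing_le (hf : SuperExpDecay f) (hg : SuperExpDecay g)
    (v : V) (P Q : ℝ) :
    ∃ K : ℝ, ∀ p q : ℂ, |p.re| ≤ P → |q.re| ≤ Q → ‖weightPairing f v g p q‖ ≤ K := by
  obtain ⟨C, hC⟩ := hf.exists_norm_expFourier_le v P
  refine ⟨_, fun p q hp hq => norm_integral_le_of_norm_le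
    ((hg.integrable_exp_norm_mul (Q * ‖v‖)).norm.const_mul C) (ae_of_all _ fun ξ => ?_)⟩
  rw [norm_mul]
  exact mul_le_mul (hC p hp ξ) (norm_cexp_inner_mul_le g v hq ξ) (norm_nonneg _)
    ((norm_nonneg _).trans (hC p hp ξ))

theorem SuperExpDecay.differentiable_weightPairing (hf : SuperExpDecay f) (hg : SuperExpDecay g)
    (v : V) (p₀ q₀ p₁ q₁ : ℂ) :
    Differentiable ℂ (fun z => weightPairing f v g (p₀ + z * p₁) (q₀ + z * q₁)) := by
  refine differentiable_integral_of_dominated (fun z => ?_) (fun ξ => ?_) (fun R => ?_)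
  · exact (hf.continuous_expFourier v _).aestronglyMeasurable.mul
      (hg.aestronglyMeasurable_cexp_inner_mul v _)
  · have hd : Differentiable ℂ (fun z : ℂ => expFourier f v (p₀ + z * p₁) ξ) :=
      (hf.differentiable_expFourier v ξ).comp (by fun_prop)
    fun_prop
  · obtain ⟨C, hC⟩ := hf.exists_norm_expFourier_le v (‖p₀‖ + R * ‖p₁‖)
    have hre (a d : ℂ) {z : ℂ} (hz : ‖z‖ ≤ R) : |(a + z * d).re| ≤ ‖a‖ + R * ‖d‖ := by
      refine (Complex.abs_re_le_norm _).trans ((norm_add_le _ _).trans ?_)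
      rw [norm_mul]
      gcongr
    refine ⟨_, (hg.integrable_exp_norm_mul ((‖q₀‖ + R * ‖q₁‖) * ‖v‖)).norm.const_mul C,
      fun z hz ξ => ?_⟩
    rw [norm_mul]
    exact mul_le_mul (hC _ (hre p₀ p₁ hz) ξ) (norm_cexp_inner_mul_le g v (hre q₀ q₁ hz) ξ)
      (norm_nonneg _) ((norm_nonneg _).trans (hC _ (hre p₀ p₁ hz) ξ))

/-- For `g` merely in `L²` the decay needed for holomorphy in `q` comes from `𝓕 f` instead. -/
theorem SuperExpDecay.differentiable_weightPairing_right (hFf : SuperExpDecay (𝓕 f))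
    (hg : MemLp g 2) (v : V) (y : ℝ) :
    Differentiable ℂ (fun q => weightPairing f v g (y * Complex.I) q) := by
  have h := (hFf.comp_sub_right
    ((y / (2 * Real.pi)) • v)).differentiable_integral_cexp_inner_mul v hg
  simpa only [weightPairing, expFourier_mul_I, mul_assoc, mul_left_comm] using h

end WeightPairing

section ChirpDuality

variable {V : Type*} [NormedAddCommGroup V] [InnerProductSpace ℝ V] [FiniteDimensional ℝ V]
  [MeasurableSpace V] [BorelSpace V] {f g : V → ℂ}

theorem exists_fourier_ae_eq_chirp_fourier (hg : Integrable g) (hg₂ : MemLp g 2) (s : ℝ) :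
    ∃ k : Lp (α := V) ℂ 2, (𝓕 k : Lp (α := V) ℂ 2) =ᵐ[volume] chirp s (𝓕 g) ∧
      eLpNorm k 2 = eLpNorm g 2 := by
  have hmem : MemLp (chirp s (𝓕 g)) 2 := (memLp_fourier hg hg₂).congr_norm
    (aestronglyMeasurable_chirp s (memLp_fourier hg hg₂).1)
    (ae_of_all _ fun x => (norm_chirp s _ x).symm)
  have hk : (𝓕 (𝓕⁻ (hmem.toLp _)) : Lp (α := V) ℂ 2 volume) =ᵐ[volume] chirp s (𝓕 g) := by
    rw [FourierInvPair.fourier_fourierInv_eq]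
    exact hmem.coeFn_toLp
  refine ⟨𝓕⁻ (hmem.toLp _), hk, ?_⟩
  rw [← eLpNorm_fourier_L2, eLpNorm_congr_ae hk, ← eLpNorm_fourier hg hg₂]
  exact eLpNorm_congr_norm_ae (ae_of_all _ fun x => norm_chirp s _ x)

theorem cexp_inner_mul_chirp (f : V → ℂ) (s ω y : ℝ) (v x : V) :
    Complex.exp ((-(s / Real.pi) * (y * Complex.I) + ω * Complex.I) * inner ℝ v x) * chirp s f x *
        𝓕 g (x - (y / (2 * Real.pi)) • v) =
      Complex.exp (s * (y * Complex.I) ^ 2 * ‖v‖ ^ 2 / (4 * Real.pi ^ 2) * Complex.I) *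
        (Complex.exp (ω * Complex.I * inner ℝ v x) * f x *
          chirp s (𝓕 g) (x - (y / (2 * Real.pi)) • v)) := by
  have hphase : Complex.exp ((-(s / Real.pi) * (y * Complex.I) + ω * Complex.I) * inner ℝ v x) *
      Complex.exp ((s * ‖x‖ ^ 2 : ℝ) * Complex.I) =
      Complex.exp (s * (y * Complex.I) ^ 2 * ‖v‖ ^ 2 / (4 * Real.pi ^ 2) * Complex.I) *
        Complex.exp (ω * Complex.I * inner ℝ v x) *
        Complex.exp ((s * ‖x - (y / (2 * Real.pi)) • v‖ ^ 2 : ℝ) * Complex.I) := by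
    rw [← Complex.exp_add, ← Complex.exp_add, ← Complex.exp_add, norm_sub_sq_real,
      inner_smul_right, norm_smul, mul_pow, mul_pow, Real.norm_eq_abs, sq_abs,
      real_inner_comm, Complex.I_sq]
    congr 1
    push_cast
    field_simp
    ring
  simp only [chirp]
  linear_combination f x * 𝓕 g (x - (y / (2 * Real.pi)) • v) * hphase

theorem weightPairing_chirp_mul_I (hf : SuperExpDecay f) (hg : SuperExpDecay g) {s : ℝ}
    {k : Lp (α := V) ℂ 2} (hk : (𝓕 k : Lp (α := V) ℂ 2) =ᵐ[volume] chirp s (𝓕 g)) (v : V)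
    (ω y : ℝ) :
    weightPairing (chirp s f) v g (-(s / Real.pi) * (y * Complex.I) + ω * Complex.I)
        (y * Complex.I) =
      Complex.exp (s * (y * Complex.I) ^ 2 * ‖v‖ ^ 2 / (4 * Real.pi ^ 2) * Complex.I) *
        weightPairing f v k (ω * Complex.I) (y * Complex.I) := by
  set w : V := (y / (2 * Real.pi)) • v
  set c := Complex.exp (s * (y * Complex.I) ^ 2 * ‖v‖ ^ 2 / (4 * Real.pi ^ 2) * Complex.I)
  set F : V → ℂ := fun x => Complex.exp (ω * Complex.I * inner ℝ v x) * f x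
  have hmp := measurePreserving_add_right (volume : Measure V) w
  have hF : Integrable fun x => F (x + w) := (hf.integrable_cexp_inner_mul v _).comp_add_right w
  have hF₂ : MemLp (fun x => F (x + w)) 2 :=
    (hf.memLp_cexp_inner_mul v _).comp_measurePreserving hmp
  calc weightPairing (chirp s f) v g (-(s / Real.pi) * (y * Complex.I) + ω * Complex.I)
        (y * Complex.I)
      = ∫ x, Complex.exp ((-(s / Real.pi) * (y * Complex.I) + ω * Complex.I) * inner ℝ v x) *
          chirp s f x * expFourier g v (y * Complex.I) x :=
        (integral_mul_fourier_of_integrable ((hf.chirp s).integrable_cexp_inner_mul v _)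
          (hg.integrable_cexp_inner_mul v _)).symm
    _ = c * ∫ x, F x * chirp s (𝓕 g) (x - w) := by
        simp only [expFourier_mul_I, cexp_inner_mul_chirp, integral_const_mul, F, c, w]
    _ = c * ∫ x, F (x + w) * (𝓕 k : Lp (α := V) ℂ 2 volume) x := by
        rw [← integral_add_right_eq_self _ w]
        congr 1
        refine integral_congr_ae (hk.mono fun x hx => ?_)
        simp only [add_sub_cancel_right, hx]
    _ = c * ∫ ξ, 𝓕 (fun x => F (x + w)) ξ * k ξ := by rw [integral_mul_fourier_L2 hF hF₂]
    _ = c * weightPairing f v k (ω * Complex.I) (y * Complex.I) := by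
        congr 1
        refine integral_congr_ae (ae_of_all _ fun ξ => ?_)
        beta_reduce
        rw [fourier_comp_add_right, inner_smul_left, expFourier, mul_comm (Complex.exp _),
          mul_assoc]
        congr 3
        simp only [conj_trivial]
        push_cast
        field_simp

/-- Both sides are entire in `z`, so it suffices to compare them on the imaginary axis, where the
exponential weights are modulations and translations. -/
theorem weightPairing_chirp (hf : SuperExpDecay f) (hFf : SuperExpDecay (𝓕 f))
    (hg : SuperExpDecay g) {s : ℝ} {k : Lp (α := V) ℂ 2}
    (hk : (𝓕 k : Lp (α := V) ℂ 2) =ᵐ[volume] chirp s (𝓕 g)) (v : V) (ω : ℝ) (z : ℂ) :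
    weightPairing (chirp s f) v g (-(s / Real.pi) * z + ω * Complex.I) z =
      Complex.exp (s * z ^ 2 * ‖v‖ ^ 2 / (4 * Real.pi ^ 2) * Complex.I) *
        weightPairing f v k (ω * Complex.I) z := by
  have hl : Differentiable ℂ fun z =>
      weightPairing (chirp s f) v g (-(s / Real.pi) * z + ω * Complex.I) z := by
    have h := (hf.chirp s).differentiable_weightPairing hg v (ω * Complex.I) 0 (-(s / Real.pi)) 1
    convert! h using 3 <;> ring
  have hr : Differentiable ℂ fun z : ℂ =>
      Complex.exp (s * z ^ 2 * ‖v‖ ^ 2 / (4 * Real.pi ^ 2) * Complex.I) *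
        weightPairing f v k (ω * Complex.I) z := by
    have h := hFf.differentiable_weightPairing_right (Lp.memLp k) v ω
    fun_prop
  exact congrFun (eq_of_forall_eq_ofReal_mul_I hl hr fun y =>
    weightPairing_chirp_mul_I hf hg hk v ω y) z

end ChirpDuality

section LinearWeights

variable {n : ℕ} {f : Rn n → ℂ}

theorem expWeightNorm_inner_comp_sub (q : ℝ) (hf : AEStronglyMeasurable f) (v w : Rn n) :
    expWeightNorm (fun ξ => q * inner ℝ v ξ) (fun ξ => f (ξ - w)) =
      ENNReal.ofReal (Real.exp (q * inner ℝ v w)) *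
        expWeightNorm (fun ξ => q * inner ℝ v ξ) f := by
  set F : Rn n → ℂ := fun ξ => (Real.exp (q * inner ℝ v ξ) : ℂ) * f ξ
  have htranslate : (fun ξ => (Real.exp (q * inner ℝ v ξ) : ℂ) * f (ξ - w)) =
      (Real.exp (q * inner ℝ v w) : ℂ) • (F ∘ fun ξ => ξ - w) := by
    funext ξ
    simp only [F, Pi.smul_apply, Function.comp_apply, smul_eq_mul]
    rw [← mul_assoc, ← Complex.ofReal_mul, ← Real.exp_add, inner_sub_right]
    ring_nf
  have hF : AEStronglyMeasurable F := (Continuous.aestronglyMeasurable (by fun_prop)).mul hf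
  rw [expWeightNorm, htranslate, eLpNorm_const_smul,
    eLpNorm_comp_measurePreserving hF (measurePreserving_sub_right volume w),
    ← ofReal_norm, Complex.norm_real, Real.norm_of_nonneg (Real.exp_pos _).le, expWeightNorm]

theorem expWeightNorm_zero_expFourier (hf : SuperExpDecay f) (v : Rn n) (p : ℝ) :
    expWeightNorm (fun ξ => 0 * inner ℝ v ξ) (expFourier f v p) =
      expWeightNorm (fun x => p * inner ℝ v x) f := by
  simp only [expWeightNorm, zero_mul, Real.exp_zero, Complex.ofReal_one, one_mul]
  rw [expFourier, eLpNorm_fourier (hf.integrable_cexp_inner_mul v p)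
    (hf.memLp_cexp_inner_mul v p)]
  simp only [Complex.ofReal_exp, Complex.ofReal_mul]

theorem SuperExpDecay.expWeightNorm_inner_ne_top (hf : SuperExpDecay f) (q : ℝ) (v : Rn n) :
    expWeightNorm (fun x => q * inner ℝ v x) f ≠ ∞ := by
  simpa only [expWeightNorm, Complex.ofReal_exp, Complex.ofReal_mul] using
    (hf.memLp_cexp_inner_mul v q).eLpNorm_ne_top

theorem SuperExpDecay.enorm_weightPairing_le (hf : SuperExpDecay f) {g : Rn n → ℂ}
    (hg : AEStronglyMeasurable g) (v : Rn n) (p q y y' : ℝ) :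
    ‖weightPairing f v g (p + y * Complex.I) (q + y' * Complex.I)‖ₑ ≤
      ENNReal.ofReal (Real.exp (q * (y / (2 * Real.pi)) * ‖v‖ ^ 2)) *
        expWeightNorm (fun ξ => q * inner ℝ v ξ) (expFourier f v p) * eLpNorm g 2 := by
  have hcont := hf.continuous_expFourier v (p + y * Complex.I)
  have hnorm : eLpNorm (fun ξ => Complex.exp ((q + y' * Complex.I) * inner ℝ v ξ) *
      expFourier f v (p + y * Complex.I) ξ) 2 =
      ENNReal.ofReal (Real.exp (q * (y / (2 * Real.pi)) * ‖v‖ ^ 2)) *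
        expWeightNorm (fun ξ => q * inner ℝ v ξ) (expFourier f v p) := by
    have h := expWeightNorm_inner_comp_sub q (hf.continuous_expFourier v p).aestronglyMeasurable v
      ((y / (2 * Real.pi)) • v)
    rw [inner_smul_right, real_inner_self_eq_norm_sq, ← mul_assoc] at h
    rw [← h]
    refine eLpNorm_congr_norm_ae (ae_of_all _ fun ξ => ?_)
    rw [norm_mul, norm_mul, expFourier_add_mul_I, Complex.norm_exp, Complex.norm_real,
      Real.norm_of_nonneg (Real.exp_pos _).le]
    simp
  have hpair : weightPairing f v g (p + y * Complex.I) (q + y' * Complex.I) =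
      ∫ ξ, Complex.exp ((q + y' * Complex.I) * inner ℝ v ξ) *
        expFourier f v (p + y * Complex.I) ξ * g ξ := by
    simp only [weightPairing, mul_assoc, mul_left_comm]
  rw [hpair, ← hnorm]
  exact enorm_integral_mul_le_eLpNorm_mul_eLpNorm
    (Continuous.aestronglyMeasurable (by fun_prop)) hg

theorem enorm_le_rpow_mul_rpow_of_strip {G : ℂ → ℂ} (hG : Differentiable ℂ G) {K c θ : ℝ}
    {A B : ℝ≥0∞} (hA' : A ≠ ∞) (hB' : B ≠ ∞)
    (hK : ∀ z : ℂ, z.re ∈ Icc (0 : ℝ) 1 → ‖G z‖ ≤ K)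
    (hA : ∀ y : ℝ, ‖G (y * Complex.I)‖ₑ ≤ A)
    (hB : ∀ y : ℝ, ‖G (1 + y * Complex.I)‖ₑ ≤ ENNReal.ofReal (Real.exp (-c * y)) * B)
    (hθ : θ ∈ Icc (0 : ℝ) 1) : ‖G θ‖ₑ ≤ A ^ (1 - θ) * B ^ θ := by
  have hA'' (y : ℝ) : ‖G (y * Complex.I)‖ ≤ A.toReal := by
    simpa using ENNReal.toReal_mono hA' (hA y)
  have hB'' (y : ℝ) : ‖G (1 + y * Complex.I)‖ ≤ Real.exp (-c * y) * B.toReal := by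
    simpa [ENNReal.toReal_ofReal (Real.exp_pos _).le] using
      ENNReal.toReal_mono (by finiteness) (hB y)
  have h := norm_le_rpow_mul_rpow_of_strip hG hK hA'' hB'' hθ
  have hfin : A ^ (1 - θ) * B ^ θ ≠ ∞ := ENNReal.mul_ne_top
    (ENNReal.rpow_ne_top_of_nonneg (sub_nonneg.2 hθ.2) hA')
    (ENNReal.rpow_ne_top_of_nonneg hθ.1 hB')
  rwa [ENNReal.toReal_rpow, ENNReal.toReal_rpow, ← ENNReal.toReal_mul, ← toReal_enorm,
    ENNReal.toReal_le_toReal enorm_ne_top hfin] at h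

end LinearWeights

section LinearInterpolation

variable {n : ℕ} {f g : Rn n → ℂ}

theorem enorm_weightPairing_chirp_one_add_mul_I_le (hf : SuperExpDecay f)
    (hFf : SuperExpDecay (𝓕 f)) (hg : SuperExpDecay g) (v : Rn n) (a b s y : ℝ) :
    ‖weightPairing (chirp s f) v g
        (-(s / Real.pi) * (b * (1 + y * Complex.I)) + (-(a * y) : ℝ) * Complex.I)
        (b * (1 + y * Complex.I))‖ₑ ≤
      ENNReal.ofReal (Real.exp (-(b * ‖v‖ ^ 2 / (2 * Real.pi) * (a + s * b / Real.pi)) * y)) *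
        (expWeightNorm (fun ξ => b * inner ℝ v ξ) (𝓕 f) * eLpNorm g 2) := by
  obtain ⟨k, hk, hknorm⟩ := exists_fourier_ae_eq_chirp_fourier hg.integrable hg.memLp s
  have hphase : ‖Complex.exp (s * (b * (1 + y * Complex.I)) ^ 2 * ‖v‖ ^ 2 / (4 * Real.pi ^ 2) *
      Complex.I)‖ₑ =
      ENNReal.ofReal (Real.exp (-(s * b ^ 2 * ‖v‖ ^ 2 / (2 * Real.pi ^ 2)) * y)) := by
    have hsq : s * (b * (1 + y * Complex.I)) ^ 2 * ‖v‖ ^ 2 / (4 * Real.pi ^ 2) * Complex.I =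
        ((-(s * b ^ 2 * ‖v‖ ^ 2 / (2 * Real.pi ^ 2)) * y : ℝ) : ℂ) +
          ((s * b ^ 2 * ‖v‖ ^ 2 / (4 * Real.pi ^ 2) * (1 - y ^ 2) : ℝ) : ℂ) * Complex.I := by
      push_cast
      field_simp
      ring_nf
      simp only [Complex.I_sq, Complex.I_pow_three]
      ring
    rw [← ofReal_norm, Complex.norm_exp, hsq]
    simp only [Complex.add_re, Complex.re_ofReal_mul, Complex.ofReal_re, Complex.I_re, mul_zero,
      add_zero]
  have hpair := hf.enorm_weightPairing_le (Lp.memLp k).1 v 0 b (-(a * y)) (b * y)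
  rw [Complex.ofReal_zero, zero_add, expFourier_zero, hknorm] at hpair
  have harg : (b * (1 + y * Complex.I) : ℂ) = b + (b * y : ℝ) * Complex.I := by
    push_cast
    ring
  rw [weightPairing_chirp hf hFf hg hk, enorm_mul, hphase, harg]
  refine (mul_le_mul_right hpair _).trans_eq ?_
  rw [← mul_assoc, ← mul_assoc, ← mul_assoc, ← ENNReal.ofReal_mul (Real.exp_pos _).le,
    ← Real.exp_add]
  congr 4
  field_simp
  ring

theorem enorm_weightPairing_chirp_le (hf : SuperExpDecay f) (hFf : SuperExpDecay (𝓕 f))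
    (hg : SuperExpDecay g) (v : Rn n) (a b s : ℝ) {θ : ℝ} (hθ : θ ∈ Icc (0 : ℝ) 1) :
    ‖weightPairing (chirp s f) v g (a + θ * (-a - s * b / Real.pi : ℝ)) (θ * b)‖ₑ ≤
      expWeightNorm (fun x => a * inner ℝ v x) f ^ (1 - θ) *
        expWeightNorm (fun ξ => b * inner ℝ v ξ) (𝓕 f) ^ θ * eLpNorm g 2 := by
  set H : ℂ → ℂ := fun z =>
    weightPairing (chirp s f) v g (a + z * (-a - s * b / Real.pi : ℝ)) (z * b)
  set A := expWeightNorm (fun x => a * inner ℝ v x) f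
  set B := expWeightNorm (fun ξ => b * inner ℝ v ξ) (𝓕 f)
  have hd : Differentiable ℂ H := by
    simpa only [zero_add] using (hf.chirp s).differentiable_weightPairing hg v a 0 _ b
  obtain ⟨K, hK⟩ := (hf.chirp s).exists_norm_weightPairing_le hg v
    (|a| + |-a - s * b / Real.pi|) |b|
  have hstrip (z : ℂ) (hz : z.re ∈ Icc (0 : ℝ) 1) : ‖H z‖ ≤ K := by
    have hre (d : ℝ) : |z.re * d| ≤ |d| := by
      rw [abs_mul, abs_of_nonneg hz.1]
      exact mul_le_of_le_one_left (abs_nonneg d) hz.2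
    refine hK _ _ ?_ ?_
    · rw [Complex.add_re, Complex.ofReal_re, Complex.re_mul_ofReal]
      exact (abs_add_le _ _).trans (add_le_add le_rfl (hre _))
    · rw [Complex.re_mul_ofReal]
      exact hre b
  have hleft (y : ℝ) : ‖H (y * Complex.I)‖ₑ ≤ A * eLpNorm g 2 := by
    have h := (hf.chirp s).enorm_weightPairing_le hg.aestronglyMeasurable v a 0
      (y * (-a - s * b / Real.pi)) (y * b)
    rw [expWeightNorm_zero_expFourier (hf.chirp s),
      expWeightNorm_congr_norm _ (norm_chirp s f), zero_mul, zero_mul, Real.exp_zero,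
      ENNReal.ofReal_one, one_mul] at h
    convert h using 3 <;> push_cast <;> ring
  have hright (y : ℝ) : ‖H (1 + y * Complex.I)‖ₑ ≤
      ENNReal.ofReal (Real.exp (-(b * ‖v‖ ^ 2 / (2 * Real.pi) * (a + s * b / Real.pi)) * y)) *
        (B * eLpNorm g 2) := by
    convert enorm_weightPairing_chirp_one_add_mul_I_le hf hFf hg v a b s y using 3 <;>
      push_cast <;> ring
  have hN : eLpNorm g 2 ≠ ∞ := hg.memLp.eLpNorm_ne_top
  have h := enorm_le_rpow_mul_rpow_of_strip hd
    (ENNReal.mul_ne_top (hf.expWeightNorm_inner_ne_top a v) hN)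
    (ENNReal.mul_ne_top (hFf.expWeightNorm_inner_ne_top b v) hN) hstrip hleft hright hθ
  have hθ' : 0 ≤ 1 - θ := sub_nonneg.2 hθ.2
  rwa [ENNReal.mul_rpow_of_nonneg _ _ hθ', ENNReal.mul_rpow_of_nonneg _ _ hθ.1,
    mul_mul_mul_comm, ← ENNReal.rpow_add_of_nonneg _ _ hθ' hθ.1, sub_add_cancel,
    ENNReal.rpow_one] at h

/-- The relation between `a`, `b` and `s` makes the weight on the physical side vanish at `θ`. -/
theorem expWeightNorm_inner_fourier_chirp_le (hf : SuperExpDecay f) (hFf : SuperExpDecay (𝓕 f))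
    (v : Rn n) {a b s θ : ℝ} (hθ : θ ∈ Icc (0 : ℝ) 1) (h : (1 - θ) * a = θ * (s * b / Real.pi)) :
    expWeightNorm (fun ξ => θ * b * inner ℝ v ξ) (𝓕 (chirp s f)) ≤
      expWeightNorm (fun x => a * inner ℝ v x) f ^ (1 - θ) *
        expWeightNorm (fun ξ => b * inner ℝ v ξ) (𝓕 f) ^ θ := by
  have hcont := continuous_fourier_of_integrable (hf.chirp s).integrable
  refine eLpNorm_le_of_forall_superExpDecay (by fun_prop) fun g hg => ?_
  have hp : (a + θ * (-a - s * b / Real.pi : ℝ) : ℂ) = 0 := by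
    have : a + θ * (-a - s * b / Real.pi) = 0 := by linear_combination h
    exact_mod_cast this
  convert enorm_weightPairing_chirp_le hf hFf hg v a b s hθ using 2
  rw [hp, weightPairing, expFourier_zero]
  simp only [Complex.ofReal_exp, Complex.ofReal_mul, mul_assoc, mul_left_comm]

end LinearInterpolation

section GaussianSuperposition

open ProbabilityTheory

variable {n : ℕ} {f g h : Rn n → ℂ}

theorem lintegral_exp_two_mul_inner_stdGaussian (y : Rn n) :
    ∫⁻ v, ENNReal.ofReal (Real.exp (2 * inner ℝ v y)) ∂stdGaussian (Rn n) =
      ENNReal.ofReal (Real.exp (2 * ‖y‖ ^ 2)) := by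
  have hlaw := IsGaussian.map_eq_gaussianReal (μ := stdGaussian (Rn n)) (innerSL ℝ y)
  rw [integral_strongDual_stdGaussian, variance_dual_stdGaussian, innerSL_apply_norm] at hlaw
  have hint : Integrable (fun v => Real.exp (2 * innerSL ℝ y v)) (stdGaussian (Rn n)) := by
    have := integrable_exp_mul_gaussianReal (μ := 0) (v := (‖y‖ ^ 2).toNNReal) 2
    rw [← hlaw] at this
    exact this.comp_measurable (by fun_prop)
  have hmgf := mgf_gaussianReal hlaw 2
  simp only [mgf, innerSL_apply_apply] at hmgf hint
  simp only [real_inner_comm y]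
  rw [← ofReal_integral_eq_lintegral_ofReal hint (ae_of_all _ fun v => (Real.exp_pos _).le), hmgf,
    Real.coe_toNNReal _ (sq_nonneg _)]
  ring_nf

theorem expWeightNorm_sq (w : Rn n → ℝ) (f : Rn n → ℂ) :
    expWeightNorm w f ^ 2 = ∫⁻ x, ENNReal.ofReal (Real.exp (2 * w x)) * ‖f x‖ₑ ^ 2 := by
  rw [expWeightNorm, eLpNorm_two_sq]
  refine lintegral_congr fun x => ?_
  rw [enorm_mul, mul_pow, ← ofReal_norm (Real.exp (w x) : ℂ), Complex.norm_real,
    Real.norm_of_nonneg (Real.exp_pos _).le, ← ENNReal.ofReal_pow (Real.exp_pos _).le,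
    ← Real.exp_nat_mul, Nat.cast_ofNat]

theorem expWeightNorm_add_const (w : Rn n → ℝ) (c : ℝ) (f : Rn n → ℂ) :
    expWeightNorm (fun x => w x + c) f = ENNReal.ofReal (Real.exp c) * expWeightNorm w f := by
  have h : (fun x => (Real.exp (w x + c) : ℂ) * f x) =
      (Real.exp c : ℂ) • fun x => (Real.exp (w x) : ℂ) * f x := by
    ext x
    rw [Pi.smul_apply, smul_eq_mul, Real.exp_add, Complex.ofReal_mul]
    ring
  rw [expWeightNorm, h, eLpNorm_const_smul, expWeightNorm, ← ofReal_norm, Complex.norm_real,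
    Real.norm_of_nonneg (Real.exp_pos _).le]

theorem aemeasurable_exp_inner_mul_enorm_sq (hf : AEStronglyMeasurable f) (a : Rn n) (c : ℝ) :
    AEMeasurable (fun z : Rn n × Rn n =>
      ENNReal.ofReal (Real.exp (2 * (c * inner ℝ z.1 (z.2 + a)))) * ‖f z.2‖ₑ ^ 2)
      ((stdGaussian (Rn n)).prod volume) := by
  have : AEStronglyMeasurable (fun z : Rn n × Rn n => f z.2)
    ((stdGaussian (Rn n)).prod volume) := hf.comp_snd
  fun_prop

theorem aemeasurable_expWeightNorm_inner_sq (hf : AEStronglyMeasurable f) (a : Rn n) (c : ℝ) :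
    AEMeasurable (fun v => expWeightNorm (fun x => c * inner ℝ v (x + a)) f ^ 2)
      (stdGaussian (Rn n)) := by
  simpa only [expWeightNorm_sq] using
    (aemeasurable_exp_inner_mul_enorm_sq hf a c).lintegral_prod_right'

theorem expWeightNorm_sq_eq_lintegral_stdGaussian (hf : AEStronglyMeasurable f) (a : Rn n)
    (r : ℝ) :
    expWeightNorm (fun x => ‖x + a‖ ^ 2 / r ^ 2) f ^ 2 =
      ∫⁻ v, expWeightNorm (fun x => r⁻¹ * inner ℝ v (x + a)) f ^ 2 ∂stdGaussian (Rn n) := by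
  simp only [expWeightNorm_sq]
  rw [lintegral_lintegral_swap (aemeasurable_exp_inner_mul_enorm_sq hf a r⁻¹)]
  refine lintegral_congr fun x => ?_
  have hx := lintegral_exp_two_mul_inner_stdGaussian (r⁻¹ • (x + a))
  simp only [inner_smul_right] at hx
  rw [lintegral_mul_const' _ _ (ENNReal.pow_ne_top enorm_ne_top), hx, norm_smul, mul_pow,
    Real.norm_eq_abs, sq_abs, inv_pow, div_eq_inv_mul]

theorem expWeightNorm_gaussian_le_of_forall_inner_le (hf : AEStronglyMeasurable f)
    (hg : AEStronglyMeasurable g) (hh : AEStronglyMeasurable h) {a b c : Rn n} {r s t θ : ℝ}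
    (hθ : θ ∈ Icc (0 : ℝ) 1)
    (H : ∀ v, expWeightNorm (fun x => r⁻¹ * inner ℝ v (x + a)) f ≤
      expWeightNorm (fun x => s⁻¹ * inner ℝ v (x + b)) g ^ (1 - θ) *
        expWeightNorm (fun x => t⁻¹ * inner ℝ v (x + c)) h ^ θ) :
    expWeightNorm (fun x => ‖x + a‖ ^ 2 / r ^ 2) f ≤
      expWeightNorm (fun x => ‖x + b‖ ^ 2 / s ^ 2) g ^ (1 - θ) *
        expWeightNorm (fun x => ‖x + c‖ ^ 2 / t ^ 2) h ^ θ := by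
  have hsq (x y : ℝ≥0∞) : (x ^ (1 - θ) * y ^ θ) ^ 2 = (x ^ 2) ^ (1 - θ) * (y ^ 2) ^ θ := by
    simp only [mul_pow, ← ENNReal.rpow_natCast, ← ENNReal.rpow_mul, mul_comm]
  rw [← ENNReal.pow_le_pow_left_iff two_ne_zero, hsq, expWeightNorm_sq_eq_lintegral_stdGaussian hf,
    expWeightNorm_sq_eq_lintegral_stdGaussian hg, expWeightNorm_sq_eq_lintegral_stdGaussian hh]
  calc
    _ ≤ ∫⁻ v, (expWeightNorm (fun x => s⁻¹ * inner ℝ v (x + b)) g ^ 2) ^ (1 - θ) *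
          (expWeightNorm (fun x => t⁻¹ * inner ℝ v (x + c)) h ^ 2) ^ θ ∂stdGaussian (Rn n) :=
      lintegral_mono fun v => (pow_le_pow_left' (H v) 2).trans_eq (hsq _ _)
    _ ≤ _ := ENNReal.lintegral_mul_norm_pow_le (aemeasurable_expWeightNorm_inner_sq hg b _)
      (aemeasurable_expWeightNorm_inner_sq hh c _) (sub_nonneg.2 hθ.2) hθ.1 (sub_add_cancel _ _)

theorem expWeightNorm_gaussian_fourier_chirp_le (hf : SuperExpDecay f)
    (hFf : SuperExpDecay (𝓕 f)) (c : Rn n) {r r₀ r₁ s θ : ℝ} (hθ : θ ∈ Icc (0 : ℝ) 1)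
    (hr : r⁻¹ = θ * r₁⁻¹) (hs : (1 - θ) * r₀⁻¹ = s * r⁻¹ / Real.pi) :
    expWeightNorm (fun ξ => ‖ξ + c‖ ^ 2 / r ^ 2) (𝓕 (chirp s f)) ≤
      expWeightNorm (fun x => ‖x‖ ^ 2 / r₀ ^ 2) f ^ (1 - θ) *
        expWeightNorm (fun ξ => ‖ξ + c‖ ^ 2 / r₁ ^ 2) (𝓕 f) ^ θ := by
  have hcont := continuous_fourier_of_integrable (hf.chirp s).integrable
  have hlin (v : Rn n) := expWeightNorm_inner_fourier_chirp_le hf hFf v hθ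
    (show (1 - θ) * r₀⁻¹ = θ * (s * r₁⁻¹ / Real.pi) by rw [hs, hr]; ring)
  have key := expWeightNorm_gaussian_le_of_forall_inner_le (b := 0) (r := r) (s := r₀) (t := r₁)
    (a := c) (c := c) hcont.aestronglyMeasurable hf.aestronglyMeasurable hFf.aestronglyMeasurable
    hθ fun v => ?_
  · simpa only [add_zero] using key
  simp only [inner_add_right, add_zero, mul_add, expWeightNorm_add_const]
  rw [ENNReal.mul_rpow_of_nonneg _ _ hθ.1, mul_left_comm,
    ENNReal.ofReal_rpow_of_pos (Real.exp_pos _), ← Real.exp_mul, hr,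
    show θ * r₁⁻¹ * inner ℝ v c = r₁⁻¹ * inner ℝ v c * θ by ring]
  exact mul_le_mul_right (hlin v) _

end GaussianSuperposition

section Nondegeneracy

variable {n : ℕ}

theorem expWeightNorm_eq_zero_iff {w : Rn n → ℝ} (hw : Continuous w) {f : Rn n → ℂ}
    (hf : AEStronglyMeasurable f) : expWeightNorm w f = 0 ↔ eLpNorm f 2 = 0 := by
  have hm : AEStronglyMeasurable (fun x => (Real.exp (w x) : ℂ) * f x) :=
    (Continuous.aestronglyMeasurable (by fun_prop)).mul hf
  rw [expWeightNorm, eLpNorm_eq_zero_iff hm two_ne_zero, eLpNorm_eq_zero_iff hf two_ne_zero]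
  refine Filter.eventually_congr (ae_of_all _ fun x => ?_)
  simp

theorem expWeightNorm_fourierHat_eq_zero_iff {w : Rn n → ℝ} (hw : Continuous w) (f : L2Rn n) :
    expWeightNorm w (fourierHat f) = 0 ↔ eLpNorm f 2 = 0 := by
  rw [expWeightNorm_fourierHat, expWeightNorm_eq_zero_iff (by fun_prop) (Lp.aestronglyMeasurable _),
    eLpNorm_fourier_L2]

theorem superExpDecay_of_expWeightNorm_ne_top {f : Rn n → ℂ} (hf : AEStronglyMeasurable f)
    (a : Rn n) {r : ℝ} (hr : 0 < r) (h : expWeightNorm (fun x => ‖x + a‖ ^ 2 / r ^ 2) f ≠ ∞) :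
    SuperExpDecay f :=
  superExpDecay_of_memLp_exp_sq hf a hr
    ⟨(Continuous.aestronglyMeasurable (by fun_prop)).mul hf, h.lt_top⟩

theorem le_rpow_mul_rpow_of_ne_top {a b c : ℝ≥0∞} {θ : ℝ} (hθ : θ ∈ Ioo (0 : ℝ) 1)
    (hb : b = 0 → a = 0) (hc : c = 0 → a = 0)
    (h : b ≠ ∞ → c ≠ ∞ → a ≤ b ^ θ * c ^ (1 - θ)) : a ≤ b ^ θ * c ^ (1 - θ) := by
  have hθ' : 0 < 1 - θ := sub_pos.2 hθ.2
  by_cases hb₀ : b = 0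
  · simp [hb hb₀]
  by_cases hc₀ : c = 0
  · simp [hc hc₀]
  by_cases hb' : b = ∞
  · rw [hb', ENNReal.top_rpow_of_pos hθ.1, ENNReal.top_mul]
    · exact le_top
    · simp [ENNReal.rpow_eq_zero_iff, hc₀, hθ'.le.not_gt]
  by_cases hc' : c = ∞
  · rw [hc', ENNReal.top_rpow_of_pos hθ', ENNReal.mul_top]
    · exact le_top
    · simp [ENNReal.rpow_eq_zero_iff, hb₀, hθ.1.le.not_gt]
  exact h hb' hc'

end Nondegeneracy

section GaussianDecay

variable {n : ℕ} {u₀ : L2Rn n} {u : ℝ → L2Rn n}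

theorem norm_smul_add_smul_sq_div_sq (x ν : Rn n) {q : ℝ} (hq : q ≠ 0) (c r : ℝ) :
    ‖q • x + c • ν‖ ^ 2 / r ^ 2 = ‖x + (c / q) • ν‖ ^ 2 / (r / q) ^ 2 := by
  rw [show q • x + c • ν = q • (x + (c / q) • ν) by
    rw [smul_add, smul_smul, mul_div_cancel₀ _ hq], norm_smul, mul_pow, Real.norm_eq_abs, sq_abs]
  field_simp

theorem expWeightNorm_gaussian_fourierHat (hu₀ : Integrable u₀) (α : ℝ) (ν : Rn n) :
    expWeightNorm (fun ξ => 4 * ‖ξ + ν‖ ^ 2 / α ^ 2) (fourierHat u₀) =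
      expWeightNorm (fun ξ => ‖ξ + (2 * Real.pi)⁻¹ • ν‖ ^ 2 / (α / (4 * Real.pi)) ^ 2)
        (𝓕 (u₀ : Rn n → ℂ)) := by
  have hae := coeFn_fourier_toLp hu₀ (Lp.memLp u₀)
  rw [Lp.toLp_coeFn] at hae
  rw [expWeightNorm_fourierHat, expWeightNorm_congr_ae _ hae]
  congr 1
  ext ξ
  have h := norm_smul_add_smul_sq_div_sq ξ ν (q := 2 * Real.pi) (by positivity) 1 (α / 2)
  rw [one_smul, one_div, div_div] at h
  rw [show 4 * Real.pi = 2 * (2 * Real.pi) by ring, ← h]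
  ring

namespace IsFreeSchrodingerSolution

theorem expWeightNorm_gaussian_eq (hu : IsFreeSchrodingerSolution u₀ u) (hu₀ : Integrable u₀)
    {t : ℝ} (ht : 0 < t) (r : ℝ) (ν : Rn n) :
    expWeightNorm (fun x => ‖x + (2 * t) • ν‖ ^ 2 / r ^ 2) (u t) =
      expWeightNorm (fun ξ => ‖ξ + (2 * Real.pi)⁻¹ • ν‖ ^ 2 / (r / (4 * Real.pi * t)) ^ 2)
        (𝓕 (chirp (1 / (4 * t)) u₀)) := by
  rw [hu.expWeightNorm_eq hu₀ ht]
  congr 1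
  ext ξ
  rw [norm_smul_add_smul_sq_div_sq _ _ (by positivity),
    show 2 * t / (4 * Real.pi * t) = (2 * Real.pi)⁻¹ by field_simp; norm_num]

theorem expWeightNorm_eq_zero_iff (hu : IsFreeSchrodingerSolution u₀ u) {t : ℝ} (ht : 0 ≤ t)
    {w : Rn n → ℝ} (hw : Continuous w) : expWeightNorm w (u t) = 0 ↔ eLpNorm u₀ 2 volume = 0 := by
  rw [_root_.expWeightNorm_eq_zero_iff hw (Lp.aestronglyMeasurable _), hu.eLpNorm_eq ht]

theorem expWeightNorm_gaussian_le_of_ne_top (hu : IsFreeSchrodingerSolution u₀ u) {α β t T θ : ℝ}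
    (hα : 0 < α) (hβ : 0 < β) (ht : 0 < t) (hT : 0 < T) (ν : Rn n) (hθ : θ ∈ Icc (0 : ℝ) 1)
    (hθt : θ = β * (T - t) / (T * (α * t + β)))
    (h₀ : expWeightNorm (fun x => ‖x‖ ^ 2 / β ^ 2) u₀ ≠ ∞)
    (hT' : expWeightNorm (fun x => ‖x + (2 * T) • ν‖ ^ 2 / (α * T + β) ^ 2) (u T) ≠ ∞) :
    expWeightNorm (fun x => ‖x + (2 * t) • ν‖ ^ 2 / (α * t + β) ^ 2) (u t) ≤
      expWeightNorm (fun x => ‖x‖ ^ 2 / β ^ 2) u₀ ^ θ *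
        expWeightNorm (fun x => ‖x + (2 * T) • ν‖ ^ 2 / (α * T + β) ^ 2) (u T) ^ (1 - θ) := by
  have hu₀ : SuperExpDecay u₀ :=
    superExpDecay_of_expWeightNorm_ne_top (Lp.aestronglyMeasurable _) 0 hβ (by simpa using h₀)
  rw [hu.expWeightNorm_gaussian_eq hu₀.integrable hT] at hT' ⊢
  rw [hu.expWeightNorm_gaussian_eq hu₀.integrable ht]
  set f := chirp (1 / (4 * T)) u₀
  have hf : SuperExpDecay f := hu₀.chirp _
  have hFf : SuperExpDecay (𝓕 f) := superExpDecay_of_expWeightNorm_ne_top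
    (continuous_fourier_of_integrable hf.integrable).aestronglyMeasurable _ (by positivity) hT'
  have hchirp : chirp (1 / (4 * t)) u₀ = chirp (1 / (4 * t) - 1 / (4 * T)) f := by
    rw [chirp_chirp, sub_add_cancel]
  have key := expWeightNorm_gaussian_fourier_chirp_le hf hFf ((2 * Real.pi)⁻¹ • ν)
    (r := (α * t + β) / (4 * Real.pi * t)) (r₀ := β) (r₁ := (α * T + β) / (4 * Real.pi * T))
    (s := 1 / (4 * t) - 1 / (4 * T)) (θ := 1 - θ)
    ⟨sub_nonneg.2 hθ.2, sub_le_self _ hθ.1⟩ ?_ ?_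
  · rwa [sub_sub_cancel, ← hchirp, expWeightNorm_congr_norm _ (norm_chirp _ u₀)] at key
  all_goals
    rw [hθt]
    field_simp
    ring

theorem expWeightNorm_gaussian_le (hu : IsFreeSchrodingerSolution u₀ u) {α β t T θ : ℝ}
    (hα : 0 < α) (hβ : 0 < β) (ht : 0 ≤ t) (htT : t ≤ T) (hT : 0 < T) (ν : Rn n)
    (hθ : θ = β * (T - t) / (T * (α * t + β))) :
    expWeightNorm (fun x => ‖x + (2 * t) • ν‖ ^ 2 / (α * t + β) ^ 2) (u t) ≤
      expWeightNorm (fun x => ‖x‖ ^ 2 / β ^ 2) u₀ ^ θ *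
        expWeightNorm (fun x => ‖x + (2 * T) • ν‖ ^ 2 / (α * T + β) ^ 2) (u T) ^ (1 - θ) := by
  rcases ht.eq_or_lt with rfl | ht
  · have : θ = 1 := by rw [hθ]; field_simp; ring
    simp [this, hu.initial]
  rcases htT.eq_or_lt with rfl | htT
  · simp [hθ]
  have hθ' : θ ∈ Ioo (0 : ℝ) 1 := by
    rw [hθ]
    refine ⟨div_pos (mul_pos hβ (sub_pos.2 htT)) (by positivity), ?_⟩
    rw [div_lt_one (by positivity)]
    nlinarith [mul_pos (mul_pos hα ht) hT, mul_pos hβ ht]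
  have hw : expWeightNorm (fun x => ‖x‖ ^ 2 / β ^ 2) u₀ = 0 ↔ eLpNorm u₀ 2 volume = 0 :=
    _root_.expWeightNorm_eq_zero_iff (by fun_prop) (Lp.aestronglyMeasurable _)
  refine le_rpow_mul_rpow_of_ne_top hθ' (fun h => ?_) (fun h => ?_)
    (hu.expWeightNorm_gaussian_le_of_ne_top hα hβ ht hT ν (Ioo_subset_Icc_self hθ') hθ)
  · rwa [hu.expWeightNorm_eq_zero_iff ht.le (by fun_prop), ← hw]
  · rw [hu.expWeightNorm_eq_zero_iff hT.le (by fun_prop)] at h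
    rwa [hu.expWeightNorm_eq_zero_iff ht.le (by fun_prop)]

theorem expWeightNorm_gaussian_le_fourierHat_of_ne_top (hu : IsFreeSchrodingerSolution u₀ u)
    {α β t θ : ℝ} (hα : 0 < α) (hβ : 0 < β) (ht : 0 < t) (ν : Rn n) (hθ : θ ∈ Icc (0 : ℝ) 1)
    (hθt : θ = β / (α * t + β))
    (h₀ : expWeightNorm (fun x => ‖x‖ ^ 2 / β ^ 2) u₀ ≠ ∞)
    (hF : expWeightNorm (fun ξ => 4 * ‖ξ + ν‖ ^ 2 / α ^ 2) (fourierHat u₀) ≠ ∞) :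
    expWeightNorm (fun x => ‖x + (2 * t) • ν‖ ^ 2 / (α * t + β) ^ 2) (u t) ≤
      expWeightNorm (fun x => ‖x‖ ^ 2 / β ^ 2) u₀ ^ θ *
        expWeightNorm (fun ξ => 4 * ‖ξ + ν‖ ^ 2 / α ^ 2) (fourierHat u₀) ^ (1 - θ) := by
  have hu₀ : SuperExpDecay u₀ :=
    superExpDecay_of_expWeightNorm_ne_top (Lp.aestronglyMeasurable _) 0 hβ (by simpa using h₀)
  rw [expWeightNorm_gaussian_fourierHat hu₀.integrable] at hF ⊢
  rw [hu.expWeightNorm_gaussian_eq hu₀.integrable ht]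
  have hFu₀ : SuperExpDecay (𝓕 (u₀ : Rn n → ℂ)) := superExpDecay_of_expWeightNorm_ne_top
    (continuous_fourier_of_integrable hu₀.integrable).aestronglyMeasurable _ (by positivity) hF
  have key := expWeightNorm_gaussian_fourier_chirp_le hu₀ hFu₀ ((2 * Real.pi)⁻¹ • ν)
    (r := (α * t + β) / (4 * Real.pi * t)) (r₀ := β) (r₁ := α / (4 * Real.pi))
    (s := 1 / (4 * t)) (θ := 1 - θ) ⟨sub_nonneg.2 hθ.2, sub_le_self _ hθ.1⟩ ?_ ?_
  · rwa [sub_sub_cancel] at key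
  all_goals
    rw [hθt]
    field_simp
    ring

theorem expWeightNorm_gaussian_le_fourierHat (hu : IsFreeSchrodingerSolution u₀ u) {α β t θ : ℝ}
    (hα : 0 < α) (hβ : 0 < β) (ht : 0 ≤ t) (ν : Rn n) (hθ : θ = β / (α * t + β)) :
    expWeightNorm (fun x => ‖x + (2 * t) • ν‖ ^ 2 / (α * t + β) ^ 2) (u t) ≤
      expWeightNorm (fun x => ‖x‖ ^ 2 / β ^ 2) u₀ ^ θ *
        expWeightNorm (fun ξ => 4 * ‖ξ + ν‖ ^ 2 / α ^ 2) (fourierHat u₀) ^ (1 - θ) := by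
  rcases ht.eq_or_lt with rfl | ht
  · have : θ = 1 := by rw [hθ, mul_zero, zero_add, div_self hβ.ne']
    simp [this, hu.initial]
  have hθ' : θ ∈ Ioo (0 : ℝ) 1 := by
    rw [hθ]
    exact ⟨by positivity, (div_lt_one (by positivity)).2 (by linarith [mul_pos hα ht])⟩
  have hw : expWeightNorm (fun x => ‖x‖ ^ 2 / β ^ 2) u₀ = 0 ↔ eLpNorm u₀ 2 volume = 0 :=
    _root_.expWeightNorm_eq_zero_iff (by fun_prop) (Lp.aestronglyMeasurable _)
  refine le_rpow_mul_rpow_of_ne_top hθ' (fun h => ?_) (fun h => ?_)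
    (hu.expWeightNorm_gaussian_le_fourierHat_of_ne_top hα hβ ht ν (Ioo_subset_Icc_self hθ') hθ)
  · rwa [hu.expWeightNorm_eq_zero_iff ht.le (by fun_prop), ← hw]
  · rw [expWeightNorm_fourierHat_eq_zero_iff (by fun_prop)] at h
    rwa [hu.expWeightNorm_eq_zero_iff ht.le (by fun_prop)]

end IsFreeSchrodingerSolution

end GaussianDecay

theorem corollary3p5 (n : ℕ) (α β : ℝ) (hα : 0 < α) (hβ : 0 < β)
    (u₀ : L2Rn n) (u : ℝ → L2Rn n) (hu : IsFreeSchrodingerSolution u₀ u) (ν : Rn n) :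
    (∀ T : ℝ, 0 < T → ∀ t : ℝ, 0 ≤ t → t ≤ T →
      expWeightNorm (fun x => ‖x + (2 * t) • ν‖ ^ 2 / (α * t + β) ^ 2) (u t) ≤
        expWeightNorm (fun x => ‖x‖ ^ 2 / β ^ 2) (u 0) ^
            (β * (T - t) / (T * (α * t + β))) *
          expWeightNorm (fun x => ‖x + (2 * T) • ν‖ ^ 2 / (α * T + β) ^ 2) (u T) ^
            (1 - β * (T - t) / (T * (α * t + β)))) ∧
    (∀ t : ℝ, 0 ≤ t →
      expWeightNorm (fun x => ‖x + (2 * t) • ν‖ ^ 2 / (α * t + β) ^ 2) (u t) ≤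
        expWeightNorm (fun x => ‖x‖ ^ 2 / β ^ 2) (u 0) ^ (β / (α * t + β)) *
          expWeightNorm (fun ξ => 4 * ‖ξ + ν‖ ^ 2 / α ^ 2) (fourierHat (u 0)) ^
            (1 - β / (α * t + β))) := by
  rw [hu.initial]
  exact ⟨fun T hT t ht htT => hu.expWeightNorm_gaussian_le hα hβ ht htT hT ν rfl,
    fun t ht => hu.expWeightNorm_gaussian_le_fourierHat hα hβ ht ν rfl⟩
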